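/- For $k \ge 1$ let $S(k)$ be the following embedded series-parallel graph. It has two yellow vertices $s, t$ and $2k$ blue vertices $b_0, \dots, b_{2k-1}$, and every yellow vertex is adjacent to every blue vertex (a copy of $K_{2,2k}$). For each yellow–blue edge $e = yb$ there is, in addition, a path $r_1 r_2 \cdots r_{2k-1}$ of red vertices; all of its vertices are adjacent to the blue endpoint $b$, and $r_1$ is adjacent to the yellow endpoint $y$. (So the yellow and blue vertices have degree $4k$ and the red ones have degree at most three.) The embedding in the plane is the one in which the blue vertices appear in the cyclic order $b_0, \dots, b_{2k-1}$ around $s$, for each $i$ the quadrilateral $s\,b_{2i}\,t\,b_{2i+1}$ is a face, the quadrilateral $s\,b_{2i+1}\,t\,b_{2i+2}$ (indices modulo $2k$) contains the four red paths that belong to its four sides, and each red path is drawn as a fan, that is, all triangles $b\,y\,r_1$ and $b\,r_j\,r_{j+1}$ are faces. Embeddings are given by the cyclic orders of the edges around the vertices, up to reflection of the whole plane; any face may be the unbounded one. A planar Lombardi drawing of a graph places the vertices at distinct points of the plane and draws each edge as a circular arc or a line segment between its endpoints, such that no edge passes through a vertex, no two edges cross or touch except at common endpoints, and at every vertex of degree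 $n$ any two consecutive edges meet at the angle $2\pi/n$. **Theorem.** For every $k > 8$, the embedded series-parallel graph $S(k)$ has no planar Lombardi drawing that respects this embedding. -/

import Mathlib

namespace Lombardi

section Drawings

variable {V : Type*}

/-- `γ`, restricted to the parameter interval `[0, 1]`, traverses a line segment or an arc of a circle
(less than the full circle) at constant speed, from one end of it to the other. -/
def IsCircularArc (γ : ℝ → ℂ) : Prop :=
  (∃ p q : ℂ, p ≠ q ∧ ∀ t : ℝ, γ t = p + t * (q - p)) ∨
  (∃ (c : ℂ) (r a b : ℝ), 0 < r ∧ a ≠ b ∧ |b - a| < 2 * Real.pi ∧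
    ∀ t : ℝ, γ t = circleMap c r (a + t * (b - a)))

/-- A drawing of a graph in the plane `ℂ` whose edges are circular arcs (or line segments).
A dart is an edge with a direction; its curve runs from its first to its second vertex, and the two
darts of an edge carry the same curve, traversed in opposite directions.
Crossings are allowed at this point. -/
structure ArcDrawing (G : SimpleGraph V) where
  /-- the position of a vertex -/
  pos : V → ℂ
  /-- the curve of an edge -/
  arc : G.Dart → ℝ → ℂ
  isCircularArc : ∀ d, IsCircularArc (arc d)
  arc_zero : ∀ d, arc d 0 = pos d.fst
  arc_one : ∀ d, arc d 1 = pos d.snd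
  arc_symm : ∀ (d : G.Dart) (t : ℝ), arc d.symm t = arc d (1 - t)

/-- A rotation system: at every vertex a list of its neighbours, each once, read as a cyclic order. -/
structure RotationSystem (G : SimpleGraph V) where
  /-- the neighbours of a vertex in cyclic order -/
  nbrs : V → List V
  nodup : ∀ v, (nbrs v).Nodup
  mem_nbrs : ∀ v w, w ∈ nbrs v ↔ G.Adj v w

/-- The mirror image of a rotation system: every cyclic order is reversed. -/
def RotationSystem.mirror {G : SimpleGraph V} (ρ : RotationSystem G) : RotationSystem G where
  nbrs v := (ρ.nbrs v).reverse
  nodup v := List.nodup_reverse.2 (ρ.nodup v)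
  mem_nbrs v w := by rw [List.mem_reverse, ρ.mem_nbrs]

namespace ArcDrawing

variable {G : SimpleGraph V} (D : ArcDrawing G)

/-- The unit tangent vector with which the directed edge `d` leaves its first vertex. -/
noncomputable def dir (d : G.Dart) : ℂ :=
  deriv (D.arc d) 0 / ‖deriv (D.arc d) 0‖

/-- No crossings: distinct vertices have distinct positions, no edge passes through a vertex,
and two edges have no common interior point. -/
def IsPlanar : Prop :=
  Function.Injective D.pos ∧
  (∀ (d : G.Dart) (v : V), ∀ t ∈ Set.Ioo (0 : ℝ) 1, D.arc d t ≠ D.pos v) ∧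
  (∀ d d' : G.Dart, d.edge ≠ d'.edge →
    ∀ t ∈ Set.Ioo (0 : ℝ) 1, ∀ t' ∈ Set.Ioo (0 : ℝ) 1, D.arc d t ≠ D.arc d' t')

/-- Equal angles: at every vertex, of degree `n` say, the `n` edges leave in `n` equally spaced
directions, so that consecutive edges meet at the angle `2π / n`. -/
def IsLombardi : Prop :=
  ∀ v : V, ∃ θ : ℝ,
    {z : ℂ | ∃ d : G.Dart, d.fst = v ∧ D.dir d = z} =
    {z : ℂ | ∃ j : ℕ, j < (G.neighborSet v).ncard ∧
      z = Complex.exp ((θ + 2 * Real.pi * j / (G.neighborSet v).ncard : ℝ) * Complex.I)}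

/-- At every vertex the edges leave, in counterclockwise order, in the cyclic order given by `ρ`. -/
def FollowsCounterclockwise (ρ : RotationSystem G) : Prop :=
  ∀ v : V, ∃ θ : Fin (ρ.nbrs v).length → ℝ,
    StrictMono θ ∧ (∀ i j, θ j < θ i + 2 * Real.pi) ∧
    ∀ (d : G.Dart) (i : Fin (ρ.nbrs v).length), d.fst = v → d.snd = (ρ.nbrs v).get i →
      D.dir d = Complex.exp (θ i * Complex.I)

/-- The drawing respects the embedding given by `ρ`. Embeddings are taken up to reflection of the
whole plane, and any face may be the unbounded one. -/
def Respects (ρ : RotationSystem G) : Prop :=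
  D.FollowsCounterclockwise ρ ∨ D.FollowsCounterclockwise ρ.mirror

end ArcDrawing

end Drawings

section SeriesParallel

/-- The names of the two yellow vertices. -/
inductive Pole : Type
  | s
  | t

/-- The two blue vertices of an empty quadrilateral: seen from `s`, the left one `l` precedes the
right one `r` in counterclockwise order. -/
inductive Side : Type
  | l
  | r

/-- The vertices of `S(k)`. The `2k` blue vertices, in cyclic order, are
`blue 0 l, blue 0 r, blue 1 l, blue 1 r, …, blue (k-1) l, blue (k-1) r`.
The red vertices `red y i σ j` form the path that belongs to the edge from `yellow y` to
`blue i σ`. -/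
inductive SVertex (k : ℕ) : Type
  | yellow (y : Pole)
  | blue (i : Fin k) (σ : Side)
  | red (y : Pole) (i : Fin k) (σ : Side) (j : Fin (2 * k - 1))

open SVertex

/-- The edges of `S(k)`, each in one direction: all yellow–blue edges, the edges along the red
paths, the edges from every red vertex to the blue end, and from the first vertex of every red path
to the yellow end, of the yellow–blue edge it belongs to. -/
def SEdge (k : ℕ) : SVertex k → SVertex k → Prop
  | yellow _, blue _ _ => True
  | blue i σ, red _ i' σ' _ => i' = i ∧ σ' = σ
  | red y i σ j, red y' i' σ' j' => y' = y ∧ i' = i ∧ σ' = σ ∧ j'.val = j.val + 1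
  | yellow y, red y' _ _ j => y' = y ∧ j.val = 0
  | _, _ => False

/-- The series-parallel graph `S(k)`. -/
def S (k : ℕ) : SimpleGraph (SVertex k) := SimpleGraph.fromRel (SEdge k)

/-- The first vertex of a red path, the one joined to the yellow vertex. -/
def redHead {k : ℕ} (y : Pole) (i : Fin k) (σ : Side) : SVertex k :=
  red y i σ ⟨0, by have := i.pos; omega⟩

/-- The red path of a yellow–blue edge, beginning at its first vertex. -/
def redPath {k : ℕ} (y : Pole) (i : Fin k) (σ : Side) : List (SVertex k) :=
  (List.finRange (2 * k - 1)).map (red y i σ)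

/-- The predecessor of a red vertex on the path that consists of the yellow vertex and the
red path. -/
def redPrev {k : ℕ} (y : Pole) (i : Fin k) (σ : Side) (j : Fin (2 * k - 1)) : SVertex k :=
  if j.val = 0 then yellow y else red y i σ ⟨j.val - 1, by omega⟩

/-- The successor of a red vertex on its path, if there is one. -/
def redNext {k : ℕ} (y : Pole) (i : Fin k) (σ : Side) (j : Fin (2 * k - 1)) : List (SVertex k) :=
  if h : j.val + 1 < 2 * k - 1 then [red y i σ ⟨j.val + 1, h⟩] else []

/-- The counterclockwise order of the neighbours of each vertex of the embedded graph `S(k)`.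
For every `i`, the quadrilateral `s, blue i l, t, blue i r` is an empty face, and the quadrilateral
`s, blue i r, t, blue (i+1) l` (with `i+1` modulo `k`) contains the red paths of its four sides. -/
def sNbrs (k : ℕ) : SVertex k → List (SVertex k)
  | yellow .s => (List.finRange k).flatMap fun i =>
      [redHead .s i .l, blue i .l, blue i .r, redHead .s i .r]
  | yellow .t => ((List.finRange k).flatMap fun i =>
      [redHead .t i .l, blue i .l, blue i .r, redHead .t i .r]).reverse
  | blue i .l => [yellow .t, yellow .s] ++ redPath .s i .l ++ (redPath .t i .l).reverse
  | blue i .r => [yellow .s, yellow .t] ++ redPath .t i .r ++ (redPath .s i .r).reverse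
  | red .s i .l j => blue i .l :: redPrev .s i .l j :: redNext .s i .l j
  | red .t i .r j => blue i .r :: redPrev .t i .r j :: redNext .t i .r j
  | red .t i .l j => blue i .l :: (redNext .t i .l j ++ [redPrev .t i .l j])
  | red .s i .r j => blue i .r :: (redNext .s i .r j ++ [redPrev .s i .r j])

theorem sNbrs_nodup (k : ℕ) (v : SVertex k) : (sNbrs k v).Nodup := by
  have hq : ∀ y : Pole, ((List.finRange k).flatMap fun i : Fin k =>
      [redHead y i .l, blue i .l, blue i .r, redHead y i .r]).Nodup := by
    intro y
    rw [List.nodup_flatMap]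
    refine ⟨fun i _ => by simp [redHead], (List.nodup_finRange k).imp ?_⟩
    intro i i' h
    simp [Function.onFun, redHead, h, List.disjoint_left]
  have hp : ∀ (y : Pole) (i : Fin k) (σ : Side), (redPath y i σ).Nodup := fun y i σ =>
    (List.nodup_finRange _).map fun j j' h => by simpa using h
  rcases v with (_ | _) | ⟨i, _ | _⟩ | ⟨_ | _, i, _ | _, j⟩
  · exact hq _
  · exact List.nodup_reverse.2 (hq _)
  all_goals simp only [sNbrs]
  iterate 2
    simp [List.nodup_append, hp]
    simp [redPath]
    try grind
  all_goals
    simp only [redPrev, redNext]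
    split_ifs <;> simp <;> omega

theorem mem_sNbrs (k : ℕ) (v w : SVertex k) : w ∈ sNbrs k v ↔ (S k).Adj v w := by
  rw [S, SimpleGraph.fromRel_adj]
  rcases v with (_ | _) | ⟨i, _ | _⟩ | ⟨_ | _, i, _ | _, j⟩ <;>
    rcases w with (_ | _) | ⟨i', _ | _⟩ | ⟨_ | _, i', _ | _, j'⟩ <;>
    simp [sNbrs, SEdge, redHead, redPath, redPrev, redNext, eq_comm] <;>
    (try split_ifs) <;> simp [Fin.ext_iff] <;> grind

/-- The embedding of `S(k)`. -/
def sEmbedding (k : ℕ) : RotationSystem (S k) where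
  nbrs := sNbrs k
  nodup := sNbrs_nodup k
  mem_nbrs := mem_sNbrs k

end SeriesParallel

end Lombardi

namespace Lombardi

open ComplexConjugate

/-! Only the spokes s–b–t through the blue vertices b matter; the red paths serve to bring the
yellow and blue degrees to 4k and so to fix the angles. Put a = π/(2k). At each pole the gaps
between consecutive spokes are alternately a (left to right, across an empty quadrilateral) and 3a,
and at b the two edges of a spoke enclose the angle a. The Möbius map (z - s)/(z - t) turns a spoke
into a circular arc from 0 to B, leaving in a direction T, followed by a ray from B in the direction
-κT. The factor κ is common to all spokes because the cyclic orders at s and t are opposite.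

Write B = |B| T cis u, so that u is the angle from tangent to chord. The angle at B gives κ = cis(2u
- a) on left spokes and κ = cis(2u + a) on right ones; thus κ determines u modulo π on each side.
Since a is small, the ray runs back almost along the arc, and planarity becomes very restrictive: a
spoke does not cross itself, so u_l < a and u_r > -a (`angle_lt_of_disjoint`,
`neg_angle_lt_of_disjoint`); the arcs of right spoke n and left spoke n+1 do not cross, so u_l(n+1)
> -3a or u_r(n) < 3a (`arc_inter_arc`); the rays of right spoke n and left spoke n+2 do not cross,
so u_l(n+2) > -3a and u_r(n) < 3a exclude each other (`ray_inter_ray`). Hence u_l(n+2) > -3a implies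
u_l(n+1) > -3a, and going round the cycle this inequality holds for all n or for none; in the second
case u_r(n) < 3a for all n. On the side so obtained all u lie in an interval of length 4a < π, hence
are equal. Then the ray of each spoke hits the arc of a neighbour on the same side unless |B|
changes strictly from one to the next, always in the same sense (`ray_inter_arc`,
`ray_inter_arc_mirror`). Around a cycle this is impossible. -/

/-- The unit complex number with argument `x`. -/
noncomputable def cis (x : ℝ) : ℂ := Complex.exp (x * Complex.I)

lemma cis_re (x : ℝ) : (cis x).re = Real.cos x := Complex.exp_ofReal_mul_I_re x

lemma cis_im (x : ℝ) : (cis x).im = Real.sin x := Complex.exp_ofReal_mul_I_im x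

lemma cis_ne_zero (x : ℝ) : cis x ≠ 0 := Complex.exp_ne_zero _

lemma norm_cis (x : ℝ) : ‖cis x‖ = 1 := Complex.norm_exp_ofReal_mul_I x

lemma cis_add (x y : ℝ) : cis (x + y) = cis x * cis y := by
  simp [cis, add_mul, Complex.exp_add]

lemma cis_neg (x : ℝ) : cis (-x) = (cis x)⁻¹ := by
  simp [cis, Complex.exp_neg]

lemma cis_sub (x y : ℝ) : cis (x - y) = cis x * (cis y)⁻¹ := by
  rw [sub_eq_add_neg, cis_add, cis_neg]

lemma cis_zero : cis 0 = 1 := by simp [cis]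

lemma conj_cis (x : ℝ) : conj (cis x) = cis (-x) := by
  apply Complex.ext <;> simp [cis_re, cis_im]

lemma cis_nat_mul (n : ℕ) (x : ℝ) : cis (n * x) = cis x ^ n := by
  simp only [cis, ← Complex.exp_nat_mul]
  push_cast
  ring_nf

lemma cis_two_pi : cis (2 * Real.pi) = 1 := by
  simp [cis, Complex.exp_two_pi_mul_I]

lemma eq_of_cis_eq {x y : ℝ} (h : cis x = cis y) (h1 : x - y < 2 * Real.pi)
    (h2 : -(2 * Real.pi) < x - y) : x = y := by
  have hc : Real.cos (x - y) = 1 := by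
    rw [← cis_re, cis_sub, h, mul_inv_cancel₀ (cis_ne_zero y), Complex.one_re]
  linarith [(Real.cos_eq_one_iff_of_lt_of_lt h2 h1).1 hc]

/-! ### Intersections of arcs from 0 and rays to infinity -/

/-- The points of the circular arc from `0` to `B` that leaves `0` in the direction `T`. -/
def arcPoints (B T : ℂ) : Set ℂ := {w | w ≠ 0 ∧ ∃ σ : ℝ, 0 < σ ∧ w⁻¹ = B⁻¹ + σ * T⁻¹}

/-- The points of the ray from `B` in the direction `V`. -/
def rayPoints (B V : ℂ) : Set ℂ := {w | ∃ τ : ℝ, 0 < τ ∧ w = B + τ * V}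

lemma mul_mem_arcPoints {B T w : ℂ} (c : ℂ) (hc : c ≠ 0) (h : w ∈ arcPoints B T) :
    c * w ∈ arcPoints (c * B) (c * T) := by
  obtain ⟨h0, σ, hσ, h⟩ := h
  refine ⟨mul_ne_zero hc h0, σ, hσ, ?_⟩
  rw [mul_inv, mul_inv, mul_inv, h]
  ring

lemma mul_mem_rayPoints {B V w : ℂ} (c : ℂ) (h : w ∈ rayPoints B V) :
    c * w ∈ rayPoints (c * B) (c * V) := by
  obtain ⟨τ, hτ, h⟩ := h
  exact ⟨τ, hτ, by rw [h]; ring⟩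

lemma conj_mem_arcPoints {B T w : ℂ} (h : w ∈ arcPoints B T) :
    conj w ∈ arcPoints (conj B) (conj T) := by
  obtain ⟨h0, σ, hσ, h⟩ := h
  refine ⟨by simpa using h0, σ, hσ, ?_⟩
  rw [← map_inv₀, h]
  simp

lemma conj_mem_rayPoints {B V w : ℂ} (h : w ∈ rayPoints B V) :
    conj w ∈ rayPoints (conj B) (conj V) := by
  obtain ⟨τ, hτ, h⟩ := h
  exact ⟨τ, hτ, by rw [h]; simp⟩

/-- Two rays in general position meet if the parameters given by Cramer's rule are positive. -/
lemma exists_ray_inter (p p' V V' : ℂ)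
    (h1 : 0 < ((p' - p) * conj V').im / (V * conj V').im)
    (h2 : 0 < ((p' - p) * conj V).im / (V * conj V').im) :
    ∃ τ τ' : ℝ, 0 < τ ∧ 0 < τ' ∧ p + τ * V = p' + τ' * V' := by
  refine ⟨_, _, h1, h2, ?_⟩
  have hD : (V * conj V').im ≠ 0 := by
    intro h
    simp [h] at h1
  have hD' : (V * conj V').im = V.im * V'.re - V.re * V'.im := by simp; ring
  generalize (V * conj V').im = x at hD hD' ⊢
  apply Complex.ext
  · simp only [Complex.add_re, Complex.re_ofReal_mul, Complex.mul_im, Complex.conj_re,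
      Complex.conj_im, Complex.sub_re, Complex.sub_im]
    field_simp
    rw [hD']
    ring
  · simp only [Complex.add_im, Complex.im_ofReal_mul, Complex.mul_im (p' - p), Complex.conj_re,
      Complex.conj_im, Complex.sub_re, Complex.sub_im]
    field_simp
    rw [hD']
    ring

/-- At its end the arc has direction cis(2u) T, so the ray encloses the angle a with the arc
traversed backwards. By the inscribed angle theorem the second intersection of ray and circle is
seen from 0 at the angle u - a from T, hence at distance R sin(u - a) / sin u; this is the witness.
The signs of the sines place it on the arc and on the ray. -/
lemma arc_inter_ray_self {a u R : ℝ} (T : ℂ) (hT : T ≠ 0) (hR : 0 < R)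
    (h1 : 0 < Real.sin a / Real.sin u) (h2 : 0 < Real.sin a / Real.sin (u - a)) :
    ∃ w, w ∈ arcPoints (R * T * cis u) T ∧
      w ∈ rayPoints (R * T * cis u) (-(cis (2 * u - a) * T)) := by
  have hu : Real.sin u ≠ 0 := by intro h; simp [h] at h1
  have hua : Real.sin (u - a) ≠ 0 := by intro h; simp [h] at h2
  have hu' : (Real.sin u : ℂ) ≠ 0 := by exact_mod_cast hu
  have hua' : (Real.sin (u - a) : ℂ) ≠ 0 := by exact_mod_cast hua
  have hR' : (R : ℂ) ≠ 0 := by exact_mod_cast hR.ne'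
  have hs : Real.sin u = Real.sin (u - a) * Real.cos a + Real.cos (u - a) * Real.sin a := by
    rw [← Real.sin_add]; ring_nf
  have id1 : (Real.sin u : ℂ) - Real.sin a * cis (u - a) = Real.sin (u - a) * (cis a)⁻¹ := by
    rw [← cis_neg]
    apply Complex.ext
    · simp only [Complex.sub_re, Complex.re_ofReal_mul, Complex.ofReal_re, cis_re, Real.cos_neg]
      rw [hs]; ring
    · simp only [Complex.sub_im, Complex.im_ofReal_mul, Complex.ofReal_im, cis_im, Real.sin_neg]
      ring
  have id2 : (Real.sin u : ℂ) * cis a - Real.sin (u - a) = Real.sin a * cis u := by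
    apply Complex.ext
    · simp only [Complex.sub_re, Complex.re_ofReal_mul, Complex.ofReal_re, cis_re, Real.sin_sub]
      ring
    · simp only [Complex.sub_im, Complex.im_ofReal_mul, Complex.ofReal_im, cis_im]
      ring
  have hca := cis_ne_zero a
  have hcu := cis_ne_zero u
  refine ⟨R * T * cis u * (Real.sin (u - a) / Real.sin u * (cis a)⁻¹), ⟨?_, ?_⟩, ?_⟩
  · simp [hR.ne', hT, hca, hcu, hua', hu', -Complex.ofReal_sin]
  · refine ⟨Real.sin a / Real.sin (u - a) / R, by positivity, ?_⟩
    have : (Real.sin a : ℂ) = ((Real.sin u : ℂ) * cis a - Real.sin (u - a)) * (cis u)⁻¹ := by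
      rw [id2]; field_simp
    rw [Complex.ofReal_div, Complex.ofReal_div, this]
    field_simp
    ring
  · refine ⟨R * (Real.sin a / Real.sin u), by positivity, ?_⟩
    have h3 : cis (2 * u - a) = cis u * cis (u - a) := by rw [← cis_add]; ring_nf
    have h4 : (Real.sin (u - a) : ℂ) / Real.sin u * (cis a)⁻¹ =
        1 - Real.sin a / Real.sin u * cis (u - a) := by
      rw [div_mul_eq_mul_div, ← id1]; field_simp
    rw [h4, h3]
    push_cast
    ring

/-- Each arc bends at least as far as the initial tangent of the other, so the two cross. Inversion
w ↦ w⁻¹ turns both arcs into rays, and Cramer's rule finds the crossing. -/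
lemma arc_inter_arc {a u v R R' : ℝ} (T : ℂ) (hT : T ≠ 0) (hR : 0 < R) (hR' : 0 < R')
    (ha : 0 < a) (ha' : a < Real.pi) (hu : -Real.pi < u) (hua : u ≤ -a)
    (hv : v < Real.pi) (hva : a ≤ v) :
    ∃ w, w ∈ arcPoints (R * (T * cis a) * cis u) (T * cis a) ∧
      w ∈ arcPoints (R' * T * cis v) T := by
  have hsa : 0 < Real.sin a := Real.sin_pos_of_pos_of_lt_pi ha ha'
  have e1 : 0 < Real.sin v := Real.sin_pos_of_pos_of_lt_pi (by linarith) hv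
  have e2 : 0 ≤ Real.sin (-(a + u)) := Real.sin_nonneg_of_nonneg_of_le_pi (by linarith) (by linarith)
  have e3 : 0 < Real.sin (-u) := Real.sin_pos_of_pos_of_lt_pi (by linarith) (by linarith)
  have e4 : 0 ≤ Real.sin (v - a) := Real.sin_nonneg_of_nonneg_of_le_pi (by linarith) (by linarith)
  rw [Real.sin_neg] at e2 e3
  have hR1 := inv_pos.2 hR
  have hR1' := inv_pos.2 hR'
  obtain ⟨τ, τ', hτ, hτ', h⟩ := exists_ray_inter (((R⁻¹ : ℝ) : ℂ) * cis (-(a + u)))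
    (((R'⁻¹ : ℝ) : ℂ) * cis (-v)) (cis (-a)) 1
    (by
      simp only [map_one, mul_one, Complex.sub_im, Complex.im_ofReal_mul, cis_im, Real.sin_neg]
      rw [← neg_div_neg_eq]
      apply div_pos <;> nlinarith [mul_pos hR1' e1, mul_nonneg hR1.le e2])
    (by
      have : (((R'⁻¹ : ℝ) : ℂ) * cis (-v) - ((R⁻¹ : ℝ) : ℂ) * cis (-(a + u))) * conj (cis (-a)) =
          ((R'⁻¹ : ℝ) : ℂ) * cis (-(v - a)) - ((R⁻¹ : ℝ) : ℂ) * cis (-u) := by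
        rw [conj_cis, sub_mul, mul_assoc, mul_assoc, ← cis_add, ← cis_add]
        ring_nf
      rw [this]
      simp only [map_one, mul_one, Complex.sub_im, Complex.im_ofReal_mul, cis_im, Real.sin_neg]
      rw [← neg_div_neg_eq]
      apply div_pos <;> nlinarith [mul_pos hR1 e3, mul_nonneg hR1'.le e4])
  have hca := cis_ne_zero a
  have hR2 : (R : ℂ) ≠ 0 := by exact_mod_cast hR.ne'
  have hR2' : (R' : ℂ) ≠ 0 := by exact_mod_cast hR'.ne'
  set g := ((R'⁻¹ : ℝ) : ℂ) * cis (-v) + τ' * 1 with hg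
  have hg0 : g ≠ 0 := by
    intro h0
    have := congrArg Complex.im h0
    simp only [hg, mul_one, Complex.add_im, Complex.im_ofReal_mul, cis_im, Real.sin_neg,
      Complex.ofReal_im, Complex.zero_im] at this
    nlinarith [mul_pos hR1' e1]
  refine ⟨T * g⁻¹, ⟨mul_ne_zero hT (inv_ne_zero hg0), τ, hτ, ?_⟩,
    ⟨mul_ne_zero hT (inv_ne_zero hg0), τ', hτ', ?_⟩⟩
  · rw [mul_inv, inv_inv, ← h, neg_add, cis_add, cis_neg, cis_neg]
    push_cast
    field_simp
  · rw [mul_inv, inv_inv, hg, cis_neg]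
    push_cast
    field_simp

/-- The rays belong to a right spoke and a left spoke whose tangents at 0 differ by 7a; u - a and u
are the chord angles that give both the same κ = cis(2u - a). -/
lemma ray_inter_ray {a u R R' : ℝ} (T : ℂ) (hR : 0 < R) (hR' : 0 < R')
    (ha' : 9 * a < Real.pi) (hu : 0 < u) (hua : u < a) :
    ∃ w, w ∈ rayPoints (R * (T * cis (7 * a)) * cis u) (-(cis (2 * u - a) * (T * cis (7 * a)))) ∧
      w ∈ rayPoints (R' * T * cis (u - a)) (-(cis (2 * u - a) * T)) := by
  have s1 : 0 < Real.sin (7 * a) := Real.sin_pos_of_pos_of_lt_pi (by linarith) (by linarith)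
  have s2 : 0 < Real.sin u := Real.sin_pos_of_pos_of_lt_pi (by linarith) (by linarith)
  have s3 : 0 < Real.sin (8 * a - u) := Real.sin_pos_of_pos_of_lt_pi (by linarith) (by linarith)
  have s4 : 0 < Real.sin (a - u) := Real.sin_pos_of_pos_of_lt_pi (by linarith) (by linarith)
  have s5 : 0 < Real.sin (u + 7 * a) := Real.sin_pos_of_pos_of_lt_pi (by linarith) (by linarith)
  have hD : -cis (2 * u + 6 * a) * conj (-cis (2 * u - a)) = cis (7 * a) := by
    rw [map_neg, neg_mul_neg, conj_cis, ← cis_add]; ring_nf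
  obtain ⟨τ, τ', hτ, hτ', h⟩ := exists_ray_inter (R * cis (7 * a + u)) (R' * cis (u - a))
    (-cis (2 * u + 6 * a)) (-cis (2 * u - a))
    (by
      rw [hD, cis_im]
      have : ((R' : ℂ) * cis (u - a) - R * cis (7 * a + u)) * conj (-cis (2 * u - a)) =
          R' * -cis (-u) + R * cis (8 * a - u) := by
        rw [map_neg, conj_cis, mul_neg, sub_mul, mul_assoc, mul_assoc, ← cis_add, ← cis_add]
        ring_nf
      rw [this]
      simp only [Complex.add_im, Complex.im_ofReal_mul, Complex.neg_im, cis_im, Real.sin_neg,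
        neg_neg]
      positivity)
    (by
      rw [hD, cis_im]
      have : ((R' : ℂ) * cis (u - a) - R * cis (7 * a + u)) * conj (-cis (2 * u + 6 * a)) =
          R' * -cis (-(u + 7 * a)) + R * cis (a - u) := by
        rw [map_neg, conj_cis, mul_neg, sub_mul, mul_assoc, mul_assoc, ← cis_add, ← cis_add]
        ring_nf
      rw [this]
      simp only [Complex.add_im, Complex.im_ofReal_mul, Complex.neg_im, cis_im, Real.sin_neg,
        neg_neg]
      positivity)
  refine ⟨T * (R * cis (7 * a + u) + τ * -cis (2 * u + 6 * a)), ⟨τ, hτ, ?_⟩, ⟨τ', hτ', ?_⟩⟩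
  · have : cis (2 * u + 6 * a) = cis (2 * u - a) * cis (7 * a) := by rw [← cis_add]; ring_nf
    rw [this, cis_add]
    ring
  · rw [h]
    ring

/-- The line of the ray separates 0 from the far end of the arc, so the arc crosses it; and the arc
lies on the side of the line through 0 and the start of the ray into which the ray points. -/
lemma ray_inter_arc_unit {a u R R' : ℝ} (hR : 0 < R) (hRR' : R ≤ R')
    (ha : 0 < a) (ha' : 18 * a ≤ Real.pi) (hu : -(3 * a) < u) (hua : u < a) :
    ∃ w, w ∈ rayPoints (R * cis u) (-cis (2 * u - a)) ∧
      w ∈ arcPoints (R' * cis (4 * a + u)) (cis (4 * a)) := by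
  have hR' : 0 < R' := by linarith
  have hcu : 0 < Real.cos u := Real.cos_pos_of_mem_Ioo ⟨by linarith, by linarith⟩
  have s1 : 0 < Real.sin (a - u) := Real.sin_pos_of_pos_of_lt_pi (by linarith) (by linarith)
  have s2 : 0 < Real.sin (4 * a) := Real.sin_pos_of_pos_of_lt_pi (by linarith) (by linarith)
  have s3 : 0 < Real.sin (4 * a - u) := Real.sin_pos_of_pos_of_lt_pi (by linarith) (by linarith)
  -- Here a must really be small: 5a - u may come close to 8a, which must not exceed π/2.
  have s4 : Real.sin (a - u) < Real.sin (5 * a - u) :=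
    Real.sin_lt_sin_of_lt_of_le_pi_div_two (by linarith) (by linarith) (by linarith)
  let den : ℝ → ℂ := fun x => x * cis (-u) + (1 - x : ℝ) * R'
  have hden : ∀ x ∈ Set.Icc (0 : ℝ) 1, den x ≠ 0 := by
    intro x hx h
    have := congrArg Complex.re h
    simp only [den, Complex.add_re, Complex.re_ofReal_mul, cis_re, Real.cos_neg,
      Complex.ofReal_re, Complex.zero_re] at this
    rcases hx.1.eq_or_lt with h0 | h0
    · subst h0; linarith
    · nlinarith [mul_pos h0 hcu, mul_nonneg (sub_nonneg.2 hx.2) hR'.le]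
  -- A parametrization of the arc from 0 (x = 0) to its end (x = 1), with (1 - x)/x as the parameter
  -- σ of `arcPoints`; f is the signed distance from the line of the ray.
  let w : ℝ → ℂ := fun x => x * R' * cis (4 * a) / den x
  let f : ℝ → ℝ := fun x => ((w x - R * cis u) * conj (-cis (2 * u - a))).im
  have hf : ContinuousOn f (Set.Icc 0 1) := by
    have hw : ContinuousOn w (Set.Icc 0 1) := by
      apply ContinuousOn.div _ _ hden
      · fun_prop
      · fun_prop
    exact Complex.continuous_im.comp_continuousOn
      ((hw.sub continuousOn_const).mul continuousOn_const)
  have hf0 : 0 < f 0 := by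
    have : (w 0 - R * cis u) * conj (-cis (2 * u - a)) = R * cis (a - u) := by
      simp only [w, map_neg, conj_cis, Complex.ofReal_zero, zero_mul, zero_div, zero_sub,
        neg_mul_neg]
      rw [mul_assoc, ← cis_add]; ring_nf
    simp only [f, this, Complex.im_ofReal_mul, cis_im]
    positivity
  have hf1 : f 1 < 0 := by
    have hw1 : w 1 = R' * cis (4 * a + u) := by
      simp [w, den, cis_neg, cis_add]; ring
    have : (w 1 - R * cis u) * conj (-cis (2 * u - a)) =
        R' * -cis (5 * a - u) + R * cis (a - u) := by
      rw [hw1, map_neg, conj_cis, mul_neg, sub_mul, mul_assoc, mul_assoc, ← cis_add, ← cis_add]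
      ring_nf
    simp only [f, this, Complex.add_im, Complex.im_ofReal_mul, Complex.neg_im, cis_im]
    nlinarith [mul_lt_mul_of_pos_left s4 hR', mul_le_mul_of_nonneg_right hRR' s1.le]
  obtain ⟨x, hx, hfx⟩ := intermediate_value_Ioo' zero_le_one hf ⟨hf1, hf0⟩
  have hd := hden x ⟨hx.1.le, hx.2.le⟩
  have hx0 : (x : ℂ) ≠ 0 := by exact_mod_cast hx.1.ne'
  have hR0' : (R' : ℂ) ≠ 0 := by exact_mod_cast hR'.ne'
  have hV : conj (-cis (2 * u - a)) * -cis (2 * u - a) = 1 := by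
    rw [map_neg, conj_cis, neg_mul_neg, ← cis_add]; simp [cis_zero]
  set τ := ((w x - R * cis u) * conj (-cis (2 * u - a))).re with hτ
  have hw : w x = R * cis u + τ * -cis (2 * u - a) := by
    have : ((w x - R * cis u) * conj (-cis (2 * u - a))) = (τ : ℂ) :=
      Complex.ext (by simp [hτ]) (by simpa [f] using hfx)
    rw [← this, mul_assoc, hV]; ring
  -- The crossing is to the left of the line through 0 and cis u; as the ray points to the left too,
  -- its parameter τ is positive.
  have hpos : 0 < (w x * cis (-u)).im := by
    have hn : 0 < Complex.normSq (den x) := Complex.normSq_pos.2 hd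
    have h1 : w x * cis (-u) = ((x * R' / Complex.normSq (den x) : ℝ) : ℂ) *
        (x * cis (4 * a) + ((1 - x) * R' : ℝ) * cis (4 * a - u)) := by
      have h2 : (den x)⁻¹ = conj (den x) * ((Complex.normSq (den x))⁻¹ : ℝ) := Complex.inv_def _
      have h3 : conj (den x) = x * cis u + ((1 - x) * R' : ℝ) := by
        simp [den, conj_cis]
      have h4 : cis (4 * a) * cis (-u) * cis u = cis (4 * a) := by
        rw [← cis_add, ← cis_add]; ring_nf
      have h5 : cis (4 * a - u) = cis (4 * a) * cis (-u) := by rw [← cis_add]; ring_nf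
      simp only [w]
      rw [div_eq_mul_inv, h2, h3, h5]
      push_cast
      linear_combination (x * R' * x / Complex.normSq (den x) : ℂ) * h4
    rw [h1, Complex.im_ofReal_mul]
    simp only [Complex.add_im, Complex.im_ofReal_mul, cis_im]
    have := hx.1
    have : 0 < 1 - x := by linarith [hx.2]
    positivity
  have hpos' : (w x * cis (-u)).im = τ * Real.sin (a - u) := by
    have : w x * cis (-u) = R + τ * -cis (-(a - u)) := by
      have h1 : cis u * cis (-u) = 1 := by rw [← cis_add]; simp [cis_zero]
      have h2 : cis (-(a - u)) = cis (2 * u - a) * cis (-u) := by rw [← cis_add]; ring_nf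
      rw [hw, h2]
      linear_combination (R : ℂ) * h1
    rw [this]
    simp only [Complex.add_im, Complex.im_ofReal_mul, Complex.neg_im, cis_im, Real.sin_neg,
      Complex.ofReal_im]
    ring
  refine ⟨w x, ⟨τ, ?_, hw⟩, ?_, (1 - x) / x, div_pos (by linarith [hx.2]) hx.1, ?_⟩
  · rw [hpos'] at hpos
    exact pos_of_mul_pos_left hpos s1.le
  · simp [w, hx0, hR0', cis_ne_zero, hd]
  · have h1 := cis_ne_zero (4 * a)
    have h2 := cis_ne_zero u
    simp only [w, den, cis_add, cis_neg]
    push_cast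
    field_simp

lemma ray_inter_arc {a u R R' : ℝ} (T : ℂ) (hT : T ≠ 0) (hR : 0 < R) (hRR' : R ≤ R')
    (ha : 0 < a) (ha' : 18 * a ≤ Real.pi) (hu : -(3 * a) < u) (hua : u < a) :
    ∃ w, w ∈ rayPoints (R * T * cis u) (-(cis (2 * u - a) * T)) ∧
      w ∈ arcPoints (R' * (T * cis (4 * a)) * cis u) (T * cis (4 * a)) := by
  obtain ⟨w, h1, h2⟩ := ray_inter_arc_unit hR hRR' ha ha' hu hua
  refine ⟨T * w, ?_, ?_⟩
  · convert mul_mem_rayPoints T h1 using 2 <;> ring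
  · convert mul_mem_arcPoints T hT h2 using 2
    rw [cis_add]; ring

/-- Complex conjugation reverses the order of the spokes and the sign of u, which reduces this to
`ray_inter_arc`. -/
lemma ray_inter_arc_mirror {a u R R' : ℝ} (T : ℂ) (hT : T ≠ 0) (hR : 0 < R) (hRR' : R ≤ R')
    (ha : 0 < a) (ha' : 18 * a ≤ Real.pi) (hu : -a < u) (hua : u < 3 * a) :
    ∃ w, w ∈ rayPoints (R * (T * cis (4 * a)) * cis u) (-(cis (2 * u + a) * (T * cis (4 * a)))) ∧
      w ∈ arcPoints (R' * T * cis u) T := by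
  have h4 := cis_ne_zero (4 * a)
  obtain ⟨w, h1, h2⟩ := ray_inter_arc (a := a) (u := -u) (conj (T * cis (4 * a)))
    (by simpa using ⟨hT, h4⟩) hR hRR' ha ha' (by linarith) (by linarith)
  refine ⟨conj w, ?_, ?_⟩
  · convert conj_mem_rayPoints h1 using 2
    · simp [conj_cis]
    · simp only [map_mul, map_neg, conj_cis, Complex.conj_conj]
      ring_nf
  · have h5 : cis (4 * a) * cis (-(4 * a)) = 1 := by rw [← cis_add]; simp [cis_zero]
    convert conj_mem_arcPoints h2 using 2
    · simp only [map_mul, conj_cis, Complex.conj_conj, Complex.conj_ofReal, neg_neg]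
      linear_combination (-R' * T * cis u) * h5
    · simp only [map_mul, conj_cis, Complex.conj_conj, neg_neg]
      linear_combination (-T) * h5

/-! ### Chord angles -/

/-- The value u = π would mean that B lies straight behind 0, with the arc reaching it through
infinity; the hypothesis `h` excludes this. -/
lemma exists_polar {B T : ℂ} (hB : B ≠ 0) (hT : ‖T‖ = 1)
    (h : ∀ σ : ℝ, 0 < σ → B⁻¹ + σ * T⁻¹ ≠ 0) :
    ∃ u : ℝ, -Real.pi < u ∧ u < Real.pi ∧ B = ‖B‖ * T * cis u := by
  have hT0 : T ≠ 0 := by intro h0; simp [h0] at hT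
  have hpol : B = ‖B‖ * T * cis (B / T).arg := by
    have := Complex.norm_mul_exp_arg_mul_I (B / T)
    rw [norm_div, hT, div_one] at this
    rw [mul_right_comm, cis, this]
    field_simp
  refine ⟨(B / T).arg, Complex.neg_pi_lt_arg _, lt_of_le_of_ne (Complex.arg_le_pi _) ?_, hpol⟩
  intro harg
  have hB' : (‖B‖ : ℂ) ≠ 0 := by simpa using hB
  have h1 : B = -(‖B‖ * T) := by
    rw [harg] at hpol
    simpa [cis, Complex.exp_pi_mul_I] using hpol
  refine h ‖B‖⁻¹ (by positivity) ?_
  nth_rewrite 1 [h1]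
  push_cast
  field_simp
  ring

lemma eq_cis_of_sq_eq {B T κ : ℂ} {u b : ℝ} (hB : B ≠ 0) (hT : T ≠ 0)
    (hu : B = ‖B‖ * T * cis u) (h : B ^ 2 = ‖B‖ ^ 2 * κ * T ^ 2 * cis b) :
    κ = cis (2 * u - b) := by
  have hB' : (‖B‖ : ℂ) ≠ 0 := by simpa using hB
  have hb := cis_ne_zero b
  have h1 : (‖B‖ * T * cis u) ^ 2 = ‖B‖ ^ 2 * κ * T ^ 2 * cis b := by rw [← hu, h]
  have h2 : cis (2 * u) = cis u ^ 2 := by rw [two_mul, cis_add, sq]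
  have h3 : cis u ^ 2 = κ * cis b := by
    have h4 : (‖B‖ : ℂ) ^ 2 * T ^ 2 ≠ 0 := by positivity
    apply mul_left_cancel₀ h4
    linear_combination h1
  rw [cis_sub, h2, h3]
  field_simp

/-- For u = a the ray runs straight into 0; for u > a it enters the disc on the inner side of the
arc and meets the arc again. -/
lemma angle_lt_of_disjoint {B T κ : ℂ} {u a : ℝ} (hB : B ≠ 0) (hT : T ≠ 0)
    (hu : B = ‖B‖ * T * cis u) (hκ : κ = cis (2 * u - a)) (ha : 0 < a) (ha' : a < Real.pi)
    (hu' : u < Real.pi) (h0 : (0 : ℂ) ∉ rayPoints B (-(κ * T)))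
    (hd : Disjoint (arcPoints B T) (rayPoints B (-(κ * T)))) : u < a := by
  have hR : 0 < ‖B‖ := norm_pos_iff.2 hB
  by_contra! hau
  rcases hau.eq_or_lt with rfl | hau
  · refine h0 ⟨‖B‖, hR, ?_⟩
    nth_rewrite 1 [hu]
    rw [hκ]
    ring_nf
  · have h1 : 0 < Real.sin a := Real.sin_pos_of_pos_of_lt_pi ha ha'
    have h2 : 0 < Real.sin u := Real.sin_pos_of_pos_of_lt_pi (by linarith) hu'
    have h3 : 0 < Real.sin (u - a) := Real.sin_pos_of_pos_of_lt_pi (by linarith) (by linarith)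
    obtain ⟨w, hw1, hw2⟩ := arc_inter_ray_self T hT hR (div_pos h1 h2) (div_pos h1 h3)
    rw [← hu, ← hκ] at hw2
    rw [← hu] at hw1
    exact Set.disjoint_left.1 hd hw1 hw2

lemma neg_angle_lt_of_disjoint {B T κ : ℂ} {u a : ℝ} (hB : B ≠ 0) (hT : T ≠ 0)
    (hu : B = ‖B‖ * T * cis u) (hκ : κ = cis (2 * u + a)) (ha : 0 < a) (ha' : a < Real.pi)
    (hu' : -Real.pi < u) (h0 : (0 : ℂ) ∉ rayPoints B (-(κ * T)))
    (hd : Disjoint (arcPoints B T) (rayPoints B (-(κ * T)))) : -a < u := by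
  have hB' : conj B = ‖conj B‖ * conj T * cis (-u) := by
    rw [RCLike.norm_conj, ← conj_cis, ← Complex.conj_ofReal ‖B‖, ← map_mul, ← map_mul, ← hu]
  have hκ' : conj κ = cis (2 * -u - a) := by
    rw [hκ, conj_cis]; ring_nf
  have := angle_lt_of_disjoint (by simpa using hB) (by simpa using hT) hB' hκ' ha ha'
    (by linarith) (fun h => h0 (by simpa using conj_mem_rayPoints h))
    (Set.disjoint_left.2 fun w h1 h2 => Set.disjoint_left.1 hd
      (by simpa using conj_mem_arcPoints h1) (by simpa using conj_mem_rayPoints h2))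
  linarith

/-! ### Going round the cycle -/

lemma false_of_strictAnti_of_periodic {f : ℕ → ℝ} {k : ℕ} (hk : 0 < k)
    (hper : ∀ n, f (n + k) = f n) (h : ∀ n, f (n + 1) < f n) : False := by
  have h1 := strictAnti_nat_of_succ_lt h hk
  have h2 := hper 0
  rw [zero_add] at h2
  exact absurd h2 h1.ne

/-- The step `h` descends only to positive indices; a detour through n + k lets it reach 0 as well.
Any n lies below some m + jk, from which one descends. -/
lemma forall_of_periodic {P : ℕ → Prop} {k : ℕ} (hk : 0 < k) (hper : ∀ n, P (n + k) → P n)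
    (h : ∀ n, P (n + 2) → P (n + 1)) {m : ℕ} (hm : P m) (hper' : ∀ n, P n → P (n + k)) (n : ℕ) :
    P n := by
  have hdown : ∀ n, P (n + 1) → P n := by
    intro n hn
    obtain ⟨j, rfl⟩ : ∃ j, k = j + 1 := ⟨k - 1, by omega⟩
    have h2 := hper' _ hn
    rw [show n + 1 + (j + 1) = n + j + 2 by omega] at h2
    exact hper _ (h _ h2)
  have hup : ∀ j, P (m + j * k) := by
    intro j
    induction j with
    | zero => simpa using hm
    | succ j ih => rw [Nat.succ_mul, ← add_assoc]; exact hper' _ ih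
  have hle : ∀ d n, P (n + d) → P n := by
    intro d
    induction d with
    | zero => exact fun n hn => hn
    | succ d ih => exact fun n hn => ih n (hdown _ hn)
  have hn : n ≤ m + n * k := by nlinarith
  apply hle (m + n * k - n)
  rw [Nat.add_sub_cancel' hn]
  exact hup n

/-- There is no cyclic sequence of pairs of disjoint paths, each consisting of a circular arc that
starts at `0` and a ray to infinity, in which the arcs start, and the rays end, in equally spaced
directions. -/
theorem no_disjoint_spokes {k : ℕ} (hk : 9 ≤ k) {a : ℝ} (ha : 2 * k * a = Real.pi) (κ : ℂ)
    (Tl Tr Bl Br : ℕ → ℂ) (hTl : ∀ n, ‖Tl n‖ = 1) (hTr : ∀ n, Tr n = Tl n * cis a)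
    (hTs : ∀ n, Tl (n + 1) = Tl n * cis (4 * a))
    (hTp : ∀ n, Tl (n + k) = Tl n)
    (hBl0 : ∀ n, Bl n ≠ 0) (hBr0 : ∀ n, Br n ≠ 0)
    (hBlp : ∀ n, Bl (n + k) = Bl n) (hBrp : ∀ n, Br (n + k) = Br n)
    (hl : ∀ n, Bl n ^ 2 = ‖Bl n‖ ^ 2 * κ * Tl n ^ 2 * cis a)
    (hr : ∀ n, Br n ^ 2 = ‖Br n‖ ^ 2 * κ * Tr n ^ 2 * cis (-a))
    (hal : ∀ n, ∀ σ : ℝ, 0 < σ → (Bl n)⁻¹ + σ * (Tl n)⁻¹ ≠ 0)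
    (har : ∀ n, ∀ σ : ℝ, 0 < σ → (Br n)⁻¹ + σ * (Tr n)⁻¹ ≠ 0)
    (h0l : ∀ n, (0 : ℂ) ∉ rayPoints (Bl n) (-(κ * Tl n)))
    (h0r : ∀ n, (0 : ℂ) ∉ rayPoints (Br n) (-(κ * Tr n)))
    (hsl : ∀ n, Disjoint (arcPoints (Bl n) (Tl n)) (rayPoints (Bl n) (-(κ * Tl n))))
    (hsr : ∀ n, Disjoint (arcPoints (Br n) (Tr n)) (rayPoints (Br n) (-(κ * Tr n))))
    (haa : ∀ n, Disjoint (arcPoints (Bl (n + 1)) (Tl (n + 1))) (arcPoints (Br n) (Tr n)))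
    (hrr : ∀ n, Disjoint (rayPoints (Bl (n + 2)) (-(κ * Tl (n + 2))))
      (rayPoints (Br n) (-(κ * Tr n))))
    (hll : ∀ n, Disjoint (rayPoints (Bl n) (-(κ * Tl n))) (arcPoints (Bl (n + 1)) (Tl (n + 1))))
    (hrr' : ∀ n, Disjoint (rayPoints (Br (n + 1)) (-(κ * Tr (n + 1))))
      (arcPoints (Br n) (Tr n))) : False := by
  have hk' : (9 : ℝ) ≤ k := by exact_mod_cast hk
  have hpi := Real.pi_pos
  have ha0 : 0 < a := by
    by_contra! h
    nlinarith
  have ha18 : 18 * a ≤ Real.pi := by nlinarith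
  have hTr1 : ∀ n, ‖Tr n‖ = 1 := fun n => by rw [hTr, norm_mul, hTl, norm_cis, one_mul]
  have hTl0 : ∀ n, Tl n ≠ 0 := fun n h => by have := hTl n; simp [h] at this
  have hTr0 : ∀ n, Tr n ≠ 0 := fun n h => by have := hTr1 n; simp [h] at this
  have hRl : ∀ n, 0 < ‖Bl n‖ := fun n => norm_pos_iff.2 (hBl0 n)
  have hRr : ∀ n, 0 < ‖Br n‖ := fun n => norm_pos_iff.2 (hBr0 n)
  choose ul hul1 hul2 hul using fun n => exists_polar (hBl0 n) (hTl n) (hal n)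
  choose ur hur1 hur2 hur using fun n => exists_polar (hBr0 n) (hTr1 n) (har n)
  have hκl := fun n => eq_cis_of_sq_eq (hBl0 n) (hTl0 n) (hul n) (hl n)
  have hκr : ∀ n, κ = cis (2 * ur n + a) := fun n => by
    rw [eq_cis_of_sq_eq (hBr0 n) (hTr0 n) (hur n) (hr n), sub_neg_eq_add]
  have hula : ∀ n, ul n < a := fun n => angle_lt_of_disjoint (hBl0 n) (hTl0 n) (hul n) (hκl n) ha0
    (by linarith) (hul2 n) (h0l n) (hsl n)
  have hura : ∀ n, -a < ur n := fun n => neg_angle_lt_of_disjoint (hBr0 n) (hTr0 n) (hur n) (hκr n)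
    ha0 (by linarith) (hur1 n) (h0r n) (hsr n)
  have hulp : ∀ n, ul (n + k) = ul n := by
    intro n
    refine eq_of_cis_eq ?_ (by linarith [hul1 n, hul2 (n + k)]) (by linarith [hul2 n, hul1 (n + k)])
    have h1 := hul (n + k)
    rw [hBlp, hTp, hul n] at h1
    have h2 : (‖Bl n‖ : ℂ) * Tl n ≠ 0 := mul_ne_zero (by simpa using hBl0 n) (hTl0 n)
    rw [← hul n] at h1
    exact (mul_left_cancel₀ h2 ((hul n).symm.trans h1)).symm
  -- The tangents of right spoke n and left spoke n+1 differ by 3a.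
  have hPQ : ∀ n, -(3 * a) < ul (n + 1) ∨ ur n < 3 * a := by
    intro n
    by_contra! h
    obtain ⟨w, h1, h2⟩ := arc_inter_arc (a := 3 * a) (Tr n) (hTr0 n) (hRl (n + 1)) (hRr n)
      (by linarith) (by linarith) (hul1 _) h.1 (hur2 _) h.2
    have h3 : Tr n * cis (3 * a) = Tl (n + 1) := by
      rw [hTs, hTr, mul_assoc, ← cis_add]; ring_nf
    rw [h3, ← hul] at h1
    rw [← hur] at h2
    exact Set.disjoint_left.1 (haa n) h1 h2
  -- The two values of κ agree only modulo 2π as angles, but the bounds on u leave no room for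
  -- another multiple. Skipping to n+2 is what makes the alternative `hPQ` propagate from n+2 to
  -- n+1.
  have hPQ' : ∀ n, -(3 * a) < ul (n + 2) → ¬ ur n < 3 * a := by
    intro n h1 h2
    have h3 : 2 * ul (n + 2) - a = 2 * ur n + a :=
      eq_of_cis_eq ((hκl _).symm.trans (hκr n)) (by linarith [hula (n + 2), hura n])
        (by linarith [hula (n + 2), hura n])
    have h4 : ur n = ul (n + 2) - a := by linarith
    obtain ⟨w, h5, h6⟩ := ray_inter_ray (a := a) (u := ul (n + 2)) (Tr n) (hRl (n + 2)) (hRr n)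
      (by linarith) (by linarith [hura n]) (hula _)
    have h7 : Tr n * cis (7 * a) = Tl (n + 2) := by
      rw [hTs, hTs, hTr, mul_assoc, mul_assoc, ← cis_add, ← cis_add]; ring_nf
    rw [h7, ← hul, ← hκl] at h5
    rw [← h4, ← hur, ← hκl] at h6
    exact Set.disjoint_left.1 (hrr n) h5 h6
  by_cases hP : ∃ n, -(3 * a) < ul n
  · obtain ⟨m, hm⟩ := hP
    have hall := forall_of_periodic (P := fun n => -(3 * a) < ul n) (by omega : 0 < k)
      (fun n h => by rwa [hulp] at h) (fun n h => (hPQ n).resolve_right (hPQ' n h)) hm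
      (fun n h => by rwa [hulp])
    refine false_of_strictAnti_of_periodic (f := fun n => ‖Bl n‖) (by omega : 0 < k)
      (fun n => by simp only [hBlp]) fun n => ?_
    by_contra! hle
    -- All chord angles on this side are equal, since 2u is known modulo 2π and u lies in an
    -- interval of length 4a.
    have h1 : ul (n + 1) = ul n := by
      have := eq_of_cis_eq ((hκl (n + 1)).symm.trans (hκl n))
        (by linarith [hula (n + 1), hall n]) (by linarith [hula n, hall (n + 1)])
      linarith
    obtain ⟨w, h2, h3⟩ := ray_inter_arc (Tl n) (hTl0 n) (hRl n) hle ha0 ha18 (hall n) (hula n)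
    rw [← hul, ← hκl] at h2
    rw [← hTs, ← h1, ← hul] at h3
    exact Set.disjoint_left.1 (hll n) h2 h3
  · have hall : ∀ n, ur n < 3 * a := fun n => (hPQ n).resolve_left fun h => hP ⟨_, h⟩
    refine false_of_strictAnti_of_periodic (f := fun n => -‖Br n‖) (by omega : 0 < k)
      (fun n => by simp only [hBrp]) fun n => ?_
    by_contra! hle
    have h1 : ur (n + 1) = ur n := by
      have := eq_of_cis_eq ((hκr (n + 1)).symm.trans (hκr n))
        (by linarith [hall (n + 1), hura n]) (by linarith [hura (n + 1), hall n])
      linarith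
    obtain ⟨w, h2, h3⟩ := ray_inter_arc_mirror (Tr n) (hTr0 n) (hRr (n + 1))
      (neg_le_neg_iff.1 hle) ha0 ha18 (hura n) (hall n)
    have h4 : Tr n * cis (4 * a) = Tr (n + 1) := by
      rw [hTr, hTr, hTs]; ring
    rw [h4, ← h1, ← hur, ← hκr] at h2
    rw [← hur] at h3
    exact Set.disjoint_left.1 (hrr' n) h2 h3

/-! ### Edges as point sets, and the passage to spokes -/

/-- The points of the circular arc from `p` to `q` that leaves `p` in the direction `S`. -/
def edgePoints (p q S : ℂ) : Set ℂ :=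
  {z | ∃ τ : ℝ, 0 < τ ∧ (z - p) * (q - p) = τ * S * (q - z)}

lemma conj_mem_edgePoints {p q S z : ℂ} (h : z ∈ edgePoints p q S) :
    conj z ∈ edgePoints (conj p) (conj q) (conj S) := by
  obtain ⟨τ, hτ, h⟩ := h
  refine ⟨τ, hτ, ?_⟩
  simpa using congrArg conj h

/-- The directions and the disjointness properties of the edges from two vertices `s` and `t` to
common neighbours `b`, in which the neighbours are arranged as the blue vertices of `S(k)`. The edges
leave `s` and `t` in the directions `S` and `Q`. -/
structure Spokes (k : ℕ) (ω s t : ℂ) (b S Q : Side → ℕ → ℂ) : Prop where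
  poles_ne : s ≠ t
  ne_s : ∀ σ n, b σ n ≠ s
  ne_t : ∀ σ n, b σ n ≠ t
  periodic_b : ∀ σ n, b σ (n + k) = b σ n
  periodic_S : ∀ σ n, S σ (n + k) = S σ n
  norm_S : ∀ σ n, ‖S σ n‖ = 1
  norm_Q : ∀ σ n, ‖Q σ n‖ = 1
  S_r : ∀ n, S .r n = S .l n * ω
  S_succ : ∀ n, S .l (n + 1) = S .l n * ω ^ 4
  Q_r : ∀ n, Q .r n = Q .l n * ω⁻¹
  Q_succ : ∀ n, Q .l (n + 1) = Q .l n * (ω⁻¹) ^ 4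
  angle_l : ∀ n, (b .l n - s) ^ 2 * ‖b .l n - t‖ ^ 2 * Q .l n =
    (b .l n - t) ^ 2 * ‖b .l n - s‖ ^ 2 * S .l n * ω
  angle_r : ∀ n, (b .r n - s) ^ 2 * ‖b .r n - t‖ ^ 2 * Q .r n =
    (b .r n - t) ^ 2 * ‖b .r n - s‖ ^ 2 * S .r n * ω⁻¹
  bounded_s : ∀ σ n, ∀ τ : ℝ, 0 < τ → (b σ n - s) + τ * S σ n ≠ 0
  bounded_t : ∀ σ n, ∀ τ : ℝ, 0 < τ → (b σ n - t) + τ * Q σ n ≠ 0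
  t_notMem : ∀ σ n, t ∉ edgePoints s (b σ n) (S σ n)
  s_notMem : ∀ σ n, s ∉ edgePoints t (b σ n) (Q σ n)
  disjoint_s : ∀ σ σ' m n, (σ = σ' → ¬ m ≡ n [MOD k]) →
    Disjoint (edgePoints s (b σ m) (S σ m)) (edgePoints s (b σ' n) (S σ' n))
  disjoint_t : ∀ σ σ' m n, (σ = σ' → ¬ m ≡ n [MOD k]) →
    Disjoint (edgePoints t (b σ m) (Q σ m)) (edgePoints t (b σ' n) (Q σ' n))
  disjoint_s_t : ∀ σ σ' m n,
    Disjoint (edgePoints s (b σ m) (S σ m)) (edgePoints t (b σ' n) (Q σ' n))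

lemma disjoint_edgePoints_conj {p q S p' q' S' : ℂ}
    (h : Disjoint (edgePoints p q S) (edgePoints p' q' S')) :
    Disjoint (edgePoints (conj p) (conj q) (conj S))
      (edgePoints (conj p') (conj q') (conj S')) := by
  rw [Set.disjoint_left] at h ⊢
  intro z h1 h2
  refine @h (conj z) ?_ ?_
  · simpa using conj_mem_edgePoints h1
  · simpa using conj_mem_edgePoints h2

lemma Spokes.conj {k : ℕ} {ω s t : ℂ} {b S Q : Side → ℕ → ℂ} (h : Spokes k ω s t b S Q) :
    Spokes k (conj ω) (conj s) (conj t) (fun σ n => conj (b σ n)) (fun σ n => conj (S σ n))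
      (fun σ n => conj (Q σ n)) where
  poles_ne := fun e => h.poles_ne ((starRingEnd ℂ).injective e)
  ne_s σ n := fun e => h.ne_s σ n ((starRingEnd ℂ).injective e)
  ne_t σ n := fun e => h.ne_t σ n ((starRingEnd ℂ).injective e)
  periodic_b σ n := by rw [h.periodic_b]
  periodic_S σ n := by rw [h.periodic_S]
  norm_S σ n := by rw [RCLike.norm_conj, h.norm_S]
  norm_Q σ n := by rw [RCLike.norm_conj, h.norm_Q]
  S_r n := by rw [h.S_r, map_mul]
  S_succ n := by rw [h.S_succ, map_mul, map_pow]
  Q_r n := by rw [h.Q_r, map_mul, map_inv₀]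
  Q_succ n := by rw [h.Q_succ, map_mul, map_pow, map_inv₀]
  angle_l n := by
    rw [← map_sub, ← map_sub, RCLike.norm_conj, RCLike.norm_conj]
    simpa using congrArg (starRingEnd ℂ) (h.angle_l n)
  angle_r n := by
    rw [← map_sub, ← map_sub, RCLike.norm_conj, RCLike.norm_conj]
    simpa using congrArg (starRingEnd ℂ) (h.angle_r n)
  bounded_s σ n τ hτ e := h.bounded_s σ n τ hτ <| (starRingEnd ℂ).injective <| by simpa using e
  bounded_t σ n τ hτ e := h.bounded_t σ n τ hτ <| (starRingEnd ℂ).injective <| by simpa using e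
  t_notMem σ n e := h.t_notMem σ n (by simpa using conj_mem_edgePoints e)
  s_notMem σ n e := h.s_notMem σ n (by simpa using conj_mem_edgePoints e)
  disjoint_s σ σ' m n e := disjoint_edgePoints_conj (h.disjoint_s σ σ' m n e)
  disjoint_t σ σ' m n e := disjoint_edgePoints_conj (h.disjoint_t σ σ' m n e)
  disjoint_s_t σ σ' m n := disjoint_edgePoints_conj (h.disjoint_s_t σ σ' m n)

section Moebius

/-! The Möbius transformation `z ↦ (z - s) / (z - t)` takes `s` to `0` and `t` to infinity. -/

variable {s t b S Q w : ℂ}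

/-- The derivative of the map at s is 1/(s - t), so S goes to S/(s - t), here normalized. The value
w = 1 is the image of infinity, which `hne` keeps off the edge; elsewhere (s - tw)/(1 - w) is the
inverse map. -/
lemma mem_edgePoints_of_mem_arcPoints (hst : s ≠ t) (hs : b ≠ s) (ht : b ≠ t) (hS : S ≠ 0)
    (hne : ∀ τ : ℝ, 0 < τ → (b - s) + τ * S ≠ 0)
    (h : w ∈ arcPoints ((b - s) / (b - t)) (S / (s - t) * ‖s - t‖)) :
    w ≠ 1 ∧ (s - t * w) / (1 - w) ∈ edgePoints s b S := by
  obtain ⟨hw0, σ, hσ, h⟩ := h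
  have hst' := sub_ne_zero.2 hst
  have hs' := sub_ne_zero.2 hs
  have ht' := sub_ne_zero.2 ht
  have hN : 0 < ‖s - t‖ := norm_pos_iff.2 hst'
  have hN' : (‖s - t‖ : ℂ) ≠ 0 := by exact_mod_cast hN.ne'
  have hσ' : (σ : ℂ) ≠ 0 := by exact_mod_cast hσ.ne'
  field_simp at h
  have hw1 : w ≠ 1 := by
    rintro rfl
    refine hne (‖s - t‖ / σ) (by positivity) ?_
    push_cast
    field_simp
    apply mul_left_cancel₀ hst'
    linear_combination -h
  have hw1' : 1 - w ≠ 0 := sub_ne_zero.2 hw1.symm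
  refine ⟨hw1, ‖s - t‖ / σ, by positivity, ?_⟩
  push_cast
  field_simp
  linear_combination -h

lemma mem_edgePoints_of_mem_rayPoints (hst : s ≠ t) (ht : b ≠ t) (hQ : Q ≠ 0)
    (hne : ∀ τ : ℝ, 0 < τ → (b - t) + τ * Q ≠ 0)
    (h : w ∈ rayPoints ((b - s) / (b - t)) (-((s - t) / (Q * ‖s - t‖)))) :
    w ≠ 1 ∧ (s - t * w) / (1 - w) ∈ edgePoints t b Q := by
  obtain ⟨σ, hσ, h⟩ := h
  have hst' := sub_ne_zero.2 hst
  have ht' := sub_ne_zero.2 ht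
  have hN : 0 < ‖s - t‖ := norm_pos_iff.2 hst'
  have hN' : (‖s - t‖ : ℂ) ≠ 0 := by exact_mod_cast hN.ne'
  have hσ' : (σ : ℂ) ≠ 0 := by exact_mod_cast hσ.ne'
  field_simp at h
  have hw1 : w ≠ 1 := by
    rintro rfl
    refine hne (‖s - t‖ / σ) (by positivity) ?_
    push_cast
    field_simp
    apply mul_left_cancel₀ hst'
    linear_combination h
  have hw1' : 1 - w ≠ 0 := sub_ne_zero.2 hw1.symm
  refine ⟨hw1, ‖s - t‖ / σ, by positivity, ?_⟩
  push_cast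
  field_simp
  linear_combination h

lemma mem_edgePoints_of_inv_add_eq_zero (hst : s ≠ t) (hs : b ≠ s) (ht : b ≠ t) (hS : S ≠ 0)
    {σ : ℝ} (hσ : 0 < σ)
    (h : ((b - s) / (b - t))⁻¹ + σ * (S / (s - t) * ‖s - t‖)⁻¹ = 0) :
    t ∈ edgePoints s b S := by
  have hst' := sub_ne_zero.2 hst
  have hs' := sub_ne_zero.2 hs
  have ht' := sub_ne_zero.2 ht
  have hN : 0 < ‖s - t‖ := norm_pos_iff.2 hst'
  have hN' : (‖s - t‖ : ℂ) ≠ 0 := by exact_mod_cast hN.ne'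
  have hσ' : (σ : ℂ) ≠ 0 := by exact_mod_cast hσ.ne'
  field_simp at h
  refine ⟨‖s - t‖ / σ, by positivity, ?_⟩
  push_cast
  field_simp
  linear_combination -h

lemma mem_edgePoints_of_zero_mem_rayPoints (hst : s ≠ t) (ht : b ≠ t) (hQ : Q ≠ 0)
    (h : (0 : ℂ) ∈ rayPoints ((b - s) / (b - t)) (-((s - t) / (Q * ‖s - t‖)))) :
    s ∈ edgePoints t b Q := by
  obtain ⟨σ, hσ, h⟩ := h
  have hst' := sub_ne_zero.2 hst
  have ht' := sub_ne_zero.2 ht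
  have hN : 0 < ‖s - t‖ := norm_pos_iff.2 hst'
  have hN' : (‖s - t‖ : ℂ) ≠ 0 := by exact_mod_cast hN.ne'
  have hσ' : (σ : ℂ) ≠ 0 := by exact_mod_cast hσ.ne'
  field_simp at h
  refine ⟨‖s - t‖ / σ, by positivity, ?_⟩
  push_cast
  field_simp
  linear_combination h

lemma moebius_sq_eq {ζ : ℂ} (hst : s ≠ t) (ht : b ≠ t) (hQ : Q ≠ 0)
    (h : (b - s) ^ 2 * ‖b - t‖ ^ 2 * Q = (b - t) ^ 2 * ‖b - s‖ ^ 2 * S * ζ) :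
    ((b - s) / (b - t)) ^ 2 = ‖(b - s) / (b - t)‖ ^ 2 *
      ((s - t) ^ 2 / (Q * S * ‖s - t‖ ^ 2)) * (S / (s - t) * ‖s - t‖) ^ 2 * ζ := by
  have hst' := sub_ne_zero.2 hst
  have ht' := sub_ne_zero.2 ht
  have hN' : (‖s - t‖ : ℂ) ≠ 0 := by simpa using hst'
  have ht2 : (‖b - t‖ : ℂ) ≠ 0 := by simpa using ht'
  rw [norm_div]
  push_cast
  field_simp
  linear_combination h

end Moebius

theorem Spokes.false {k : ℕ} (hk : 9 ≤ k) {a : ℝ} (ha : 2 * k * a = Real.pi) {s t : ℂ}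
    {b S Q : Side → ℕ → ℂ} (h : Spokes k (cis a) s t b S Q) : False := by
  have hS : ∀ σ n, S σ n ≠ 0 := fun σ n e => by simpa [e] using h.norm_S σ n
  have hQ : ∀ σ n, Q σ n ≠ 0 := fun σ n e => by simpa [e] using h.norm_Q σ n
  have hst' := sub_ne_zero.2 h.poles_ne
  have hN' : (‖s - t‖ : ℂ) ≠ 0 := by simpa using hst'
  have hca := cis_ne_zero a
  let B : Side → ℕ → ℂ := fun σ n => (b σ n - s) / (b σ n - t)
  let T : Side → ℕ → ℂ := fun σ n => S σ n / (s - t) * ‖s - t‖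
  -- Near t an edge with direction Q is sent to infinity in the direction -(s - t)/Q. Dividing by -T
  -- leaves (s - t)²/(QS) up to normalization, and QS is the same for all spokes because Q and S
  -- rotate in opposite senses.
  let κ : ℂ := (s - t) ^ 2 / (Q .l 0 * S .l 0 * ‖s - t‖ ^ 2)
  have hQSl : ∀ n, Q .l n * S .l n = Q .l 0 * S .l 0 := by
    intro n
    induction n with
    | zero => rfl
    | succ n ih => rw [h.Q_succ, h.S_succ, ← ih]; field_simp
  have hQS : ∀ σ n, Q σ n * S σ n = Q .l 0 * S .l 0 := by
    rintro (_ | _) n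
    · exact hQSl n
    · rw [h.Q_r, h.S_r, ← hQSl n]; field_simp
  have hκ : ∀ σ n, κ = (s - t) ^ 2 / (Q σ n * S σ n * ‖s - t‖ ^ 2) := fun σ n => by
    rw [hQS]
  have hV : ∀ σ n, -(κ * T σ n) = -((s - t) / (Q σ n * ‖s - t‖)) := by
    intro σ n
    have := hS σ n
    have := hQ σ n
    rw [hκ σ n]
    simp only [T]
    field_simp
  have harc : ∀ σ n w, w ∈ arcPoints (B σ n) (T σ n) →
      w ≠ 1 ∧ (s - t * w) / (1 - w) ∈ edgePoints s (b σ n) (S σ n) := fun σ n w =>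
    mem_edgePoints_of_mem_arcPoints h.poles_ne (h.ne_s σ n) (h.ne_t σ n) (hS σ n) (h.bounded_s σ n)
  have hray : ∀ σ n w, w ∈ rayPoints (B σ n) (-(κ * T σ n)) →
      w ≠ 1 ∧ (s - t * w) / (1 - w) ∈ edgePoints t (b σ n) (Q σ n) := fun σ n w hw =>
    mem_edgePoints_of_mem_rayPoints h.poles_ne (h.ne_t σ n) (hQ σ n) (h.bounded_t σ n)
      (by rwa [hV] at hw)
  have hB0 : ∀ σ n, B σ n ≠ 0 := fun σ n =>
    div_ne_zero (sub_ne_zero.2 (h.ne_s σ n)) (sub_ne_zero.2 (h.ne_t σ n))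
  have hBp : ∀ σ n, B σ (n + k) = B σ n := fun σ n => by simp only [B, h.periodic_b]
  have ha' : ∀ σ n, ∀ x : ℝ, 0 < x → (B σ n)⁻¹ + x * (T σ n)⁻¹ ≠ 0 := fun σ n x hx e =>
    h.t_notMem σ n (mem_edgePoints_of_inv_add_eq_zero h.poles_ne (h.ne_s σ n) (h.ne_t σ n)
      (hS σ n) hx e)
  have h0 : ∀ σ n, (0 : ℂ) ∉ rayPoints (B σ n) (-(κ * T σ n)) := fun σ n e =>
    h.s_notMem σ n (mem_edgePoints_of_zero_mem_rayPoints h.poles_ne (h.ne_t σ n) (hQ σ n)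
      (by rwa [hV] at e))
  have hst : ∀ σ σ' m n, Disjoint (arcPoints (B σ m) (T σ m))
      (rayPoints (B σ' n) (-(κ * T σ' n))) := fun σ σ' m n => Set.disjoint_left.2 fun w h1 h2 =>
    Set.disjoint_left.1 (h.disjoint_s_t σ σ' m n) (harc _ _ _ h1).2 (hray _ _ _ h2).2
  refine no_disjoint_spokes hk ha κ (T .l) (T .r) (B .l) (B .r) (fun n => ?_) (fun n => ?_)
    (fun n => ?_) (fun n => ?_) (hB0 _) (hB0 _) (hBp _) (hBp _) (fun n => ?_) (fun n => ?_)
    (ha' _) (ha' _) (h0 _) (h0 _) (fun n => hst _ _ _ _) (fun n => hst _ _ _ _)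
    (fun n => Set.disjoint_left.2 fun w h1 h2 => Set.disjoint_left.1
      (h.disjoint_s .l .r (n + 1) n (fun e => by simp at e)) (harc _ _ _ h1).2 (harc _ _ _ h2).2)
    (fun n => Set.disjoint_left.2 fun w h1 h2 => Set.disjoint_left.1
      (h.disjoint_t .l .r (n + 2) n (fun e => by simp at e)) (hray _ _ _ h1).2 (hray _ _ _ h2).2)
    (fun n => (hst _ _ _ _).symm) (fun n => (hst _ _ _ _).symm)
  · simp only [T, norm_mul, norm_div, h.norm_S, Complex.norm_real, norm_norm]
    exact one_div_mul_cancel (norm_ne_zero_iff.2 hst')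
  · simp only [T, h.S_r]; ring
  · have : cis (4 * a) = cis a ^ 4 := by exact_mod_cast cis_nat_mul 4 a
    simp only [T, h.S_succ, this]; ring
  · simp only [T, h.periodic_S]
  · rw [hκ .l n]
    exact moebius_sq_eq h.poles_ne (h.ne_t _ _) (hQ _ _) (h.angle_l n)
  · rw [hκ .r n, cis_neg]
    exact moebius_sq_eq h.poles_ne (h.ne_t _ _) (hQ _ _) (h.angle_r n)

/-! ### Circular arcs: parameters and end directions -/

lemma cis_sub_cis (x y : ℝ) :
    cis x - cis y = 2 * Complex.I * Real.sin ((x - y) / 2) * cis ((x + y) / 2) := by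
  obtain ⟨p, hp⟩ : ∃ p, p = (x + y) / 2 := ⟨_, rfl⟩
  obtain ⟨q, hq⟩ : ∃ q, q = (x - y) / 2 := ⟨_, rfl⟩
  have hx : x = p + q := by rw [hp, hq]; ring
  have hy : y = p - q := by rw [hp, hq]; ring
  rw [← hp, ← hq, hx, hy]
  apply Complex.ext
  · rw [mul_assoc (2 * Complex.I)]
    simp [cis_re, cis_im, Real.cos_add, Real.cos_sub, -Complex.ofReal_sin]
    ring
  · rw [mul_assoc (2 * Complex.I)]
    simp [cis_re, cis_im, Real.sin_add, Real.sin_sub, -Complex.ofReal_sin]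
    ring

lemma hasDerivAt_circle_arc (c : ℂ) (r a Δ x : ℝ) :
    HasDerivAt (fun t : ℝ => circleMap c r (a + t * Δ))
      (r * Δ * Complex.I * cis (a + x * Δ)) x := by
  have h1 : HasDerivAt (fun t : ℝ => a + t * Δ) Δ x := by
    simpa using ((hasDerivAt_id x).mul_const Δ).const_add a
  refine ((hasDerivAt_circleMap c r (a + x * Δ)).scomp x h1).congr_deriv ?_
  rw [Complex.real_smul, cis]
  simp only [circleMap, zero_add]
  ring

/-- For every positive parameter an interior point of the arc satisfies the equation of
`edgePoints`. -/
lemma IsCircularArc.exists_param {γ : ℝ → ℂ} (h : IsCircularArc γ) {τ : ℝ} (hτ : 0 < τ) :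
    ∃ t ∈ Set.Ioo (0 : ℝ) 1, (γ t - γ 0) * (γ 1 - γ 0) =
      τ * (deriv γ 0 / ‖deriv γ 0‖) * (γ 1 - γ t) := by
  rcases h with ⟨p, q, hpq, hγ⟩ | ⟨c, r, a, b, hr, hab, hba, hγ⟩
  · have hd : deriv γ 0 = q - p := by
      have h1 : HasDerivAt (fun t : ℝ => p + (t : ℂ) * (q - p)) (q - p) 0 := by
        simpa using ((Complex.ofRealCLM.hasDerivAt (x := 0)).mul_const (q - p)).const_add p
      rw [funext hγ]
      exact h1.deriv
    have hqp := sub_ne_zero.2 hpq.symm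
    have hn : 0 < ‖q - p‖ := norm_pos_iff.2 hqp
    have hn' : (‖q - p‖ : ℂ) ≠ 0 := by exact_mod_cast hn.ne'
    refine ⟨τ / (τ + ‖q - p‖), ⟨by positivity, by rw [div_lt_one (by positivity)]; linarith⟩, ?_⟩
    have h3 : (τ + ‖q - p‖ : ℂ) ≠ 0 := by exact_mod_cast (by positivity : τ + ‖q - p‖ ≠ 0)
    rw [hd, hγ, hγ, hγ]
    push_cast
    field_simp
    ring
  · set Δ := b - a with hΔ
    have hΔ0 : Δ ≠ 0 := sub_ne_zero.2 hab.symm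
    have hd : deriv γ 0 = r * Δ * Complex.I * cis a := by
      rw [funext hγ, (hasDerivAt_circle_arc c r a Δ 0).deriv]
      simp
    have hn : ‖deriv γ 0‖ = r * |Δ| := by
      rw [hd]; simp [norm_cis, abs_of_pos hr]
    have hsin : 0 < Δ / |Δ| * Real.sin (Δ / 2) := by
      rcases hΔ0.lt_or_gt with h | h
      · rw [abs_of_neg h] at hba ⊢
        have : 0 < Real.sin (-(Δ / 2)) :=
          Real.sin_pos_of_pos_of_lt_pi (by linarith) (by linarith)
        rw [Real.sin_neg] at this
        rw [div_neg, div_self h.ne]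
        linarith
      · rw [abs_of_pos h] at hba ⊢
        rw [div_self h.ne', one_mul]
        exact Real.sin_pos_of_pos_of_lt_pi (by linarith) (by linarith)
    have hs0 : Real.sin (Δ / 2) ≠ 0 := fun h => by simp [h] at hsin
    -- By `cis_sub_cis` every difference of points of the arc is a real sine times a unit factor.
    -- The unit factors cancel, and the equation becomes F t = 0.
    let F : ℝ → ℝ := fun t => 2 * r * Real.sin (t * Δ / 2) * Real.sin (Δ / 2) -
      τ * (Δ / |Δ|) * Real.sin ((1 - t) * Δ / 2)
    have hF : ContinuousOn F (Set.Icc 0 1) := by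
      apply Continuous.continuousOn
      fun_prop
    have hF0 : F 0 < 0 := by
      have : F 0 = -(τ * (Δ / |Δ| * Real.sin (Δ / 2))) := by simp [F]; ring
      rw [this]
      linarith [mul_pos hτ hsin]
    have hF1 : 0 < F 1 := by
      have : F 1 = 2 * r * Real.sin (Δ / 2) ^ 2 := by simp [F]; ring
      rw [this]
      positivity
    obtain ⟨t, ht, hFt⟩ := intermediate_value_Ioo zero_le_one hF ⟨hF0, hF1⟩
    refine ⟨t, ht, ?_⟩
    have hc : ∀ x y : ℝ, γ x - γ y = r * (cis (a + x * Δ) - cis (a + y * Δ)) := by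
      intro x y
      rw [hγ, hγ]
      simp only [circleMap, cis]
      ring
    have hF' : (2 * r * Real.sin (t * Δ / 2) * Real.sin (Δ / 2) : ℂ) =
        τ * (Δ / (|Δ| : ℝ)) * Real.sin ((1 - t) * Δ / 2) := by
      exact_mod_cast sub_eq_zero.1 hFt
    have hr' : (r : ℂ) ≠ 0 := by exact_mod_cast hr.ne'
    have hΔ' : ((|Δ| : ℝ) : ℂ) ≠ 0 := by exact_mod_cast (abs_ne_zero.2 hΔ0)
    rw [hn, hd, hc, hc, hc, cis_sub_cis, cis_sub_cis, cis_sub_cis]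
    have e1 : (a + t * Δ - (a + 0 * Δ)) / 2 = t * Δ / 2 := by ring
    have e2 : (a + 1 * Δ - (a + 0 * Δ)) / 2 = Δ / 2 := by ring
    have e3 : (a + 1 * Δ - (a + t * Δ)) / 2 = (1 - t) * Δ / 2 := by ring
    have e4 : cis ((a + t * Δ + (a + 0 * Δ)) / 2) * cis ((a + 1 * Δ + (a + 0 * Δ)) / 2) =
        cis a * cis ((a + 1 * Δ + (a + t * Δ)) / 2) := by
      rw [← cis_add, ← cis_add]; ring_nf
    rw [e1, e2, e3]
    have e5 : (r : ℂ) * Δ * Complex.I * cis a / (r * |Δ| : ℝ) = Δ / (|Δ| : ℝ) * Complex.I * cis a := by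
      push_cast; field_simp
    rw [e5]
    linear_combination (4 * r ^ 2 * Complex.I ^ 2 * Real.sin (t * Δ / 2) * Real.sin (Δ / 2)) * e4
      + 2 * r * Complex.I ^ 2 * cis a * cis ((a + 1 * Δ + (a + t * Δ)) / 2) * hF'

/-- The chord makes equal angles with the tangents at the two ends, so the directions from both ends
into the arc multiply to minus the square of the unit chord vector. -/
lemma IsCircularArc.deriv_mul_deriv {γ : ℝ → ℂ} (h : IsCircularArc γ) :
    (deriv γ 0 / ‖deriv γ 0‖) * (-deriv γ 1 / ‖deriv γ 1‖) * ‖γ 1 - γ 0‖ ^ 2 =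
      -(γ 1 - γ 0) ^ 2 := by
  rcases h with ⟨p, q, hpq, hγ⟩ | ⟨c, r, a, b, hr, hab, hba, hγ⟩
  · have hd : ∀ x, deriv γ x = q - p := by
      intro x
      have h1 : HasDerivAt (fun t : ℝ => p + (t : ℂ) * (q - p)) (q - p) x := by
        simpa using ((Complex.ofRealCLM.hasDerivAt (x := x)).mul_const (q - p)).const_add p
      rw [funext hγ]
      exact h1.deriv
    have hn' : (‖q - p‖ : ℂ) ≠ 0 := by simpa using sub_ne_zero.2 hpq.symm
    rw [hd, hd, hγ, hγ]
    simp only [Complex.ofReal_one, Complex.ofReal_zero, one_mul, zero_mul, add_zero,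
      add_sub_cancel]
    field_simp
  · set Δ := b - a with hΔ
    have hΔ0 : Δ ≠ 0 := sub_ne_zero.2 hab.symm
    have hd : ∀ x, deriv γ x = r * Δ * Complex.I * cis (a + x * Δ) := fun x => by
      rw [funext hγ, (hasDerivAt_circle_arc c r a Δ x).deriv]
    have hn : ∀ x, ‖deriv γ x‖ = r * |Δ| := fun x => by
      rw [hd]; simp [norm_cis, abs_of_pos hr]
    have hc : γ 1 - γ 0 = 2 * Complex.I * (r * Real.sin (Δ / 2) : ℝ) * cis (a + Δ / 2) := by
      have e1 : (a + 1 * Δ - (a + 0 * Δ)) / 2 = Δ / 2 := by ring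
      have e2 : (a + 1 * Δ + (a + 0 * Δ)) / 2 = a + Δ / 2 := by ring
      have := cis_sub_cis (a + 1 * Δ) (a + 0 * Δ)
      rw [e1, e2] at this
      rw [hγ, hγ]
      simp only [circleMap]
      change c + r * cis (a + 1 * Δ) - (c + r * cis (a + 0 * Δ)) = _
      push_cast at this ⊢
      linear_combination (r : ℂ) * this
    have hr' : (r : ℂ) ≠ 0 := by exact_mod_cast hr.ne'
    have hΔ' : ((|Δ| : ℝ) : ℂ) ≠ 0 := by exact_mod_cast (abs_ne_zero.2 hΔ0)
    have hΔ2 : ((|Δ| : ℝ) : ℂ) ^ 2 = Δ ^ 2 := by exact_mod_cast sq_abs Δ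
    have hnc : (‖γ 1 - γ 0‖ : ℂ) ^ 2 = 4 * (r * Real.sin (Δ / 2) : ℝ) ^ 2 := by
      rw [hc]
      simp only [norm_mul, norm_cis, Complex.norm_real, Complex.norm_I, Complex.norm_ofNat,
        mul_one, Real.norm_eq_abs]
      have := sq_abs (r * Real.sin (Δ / 2))
      rw [← Complex.ofReal_pow, mul_pow, ← abs_mul, this]
      push_cast
      ring
    have e4 : cis (a + 0 * Δ) * cis (a + 1 * Δ) = cis (a + Δ / 2) ^ 2 := by
      rw [sq, ← cis_add, ← cis_add]; ring_nf
    rw [hn, hn, hnc, hd, hd, hc]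
    generalize Real.sin (Δ / 2) = x
    generalize cis (a + 0 * Δ) = y at e4 ⊢
    generalize cis (a + 1 * Δ) = z at e4 ⊢
    generalize cis (a + Δ / 2) = v at e4 ⊢
    push_cast
    field_simp
    rw [hΔ2]
    linear_combination (-4 * x ^ 2 * Δ ^ 2 : ℂ) * e4

section

variable {V : Type*} {G : SimpleGraph V} (D : ArcDrawing G)

namespace ArcDrawing

/-- The Möbius map z ↦ (z - p)(q - p)/(q - z) sends p to 0 and q to infinity with derivative 1 at p,
so it straightens the edge to the ray spanned by its direction; `edgePoints` is the preimage of this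
ray. Each τ has only one preimage, and the edge supplies it. This inclusion suffices to transfer
disjointness. -/
lemma exists_arc_eq (d : G.Dart) (hne : D.pos d.fst ≠ D.pos d.snd) {z : ℂ}
    (hz : z ∈ edgePoints (D.pos d.fst) (D.pos d.snd) (D.dir d)) :
    ∃ t ∈ Set.Ioo (0 : ℝ) 1, D.arc d t = z := by
  obtain ⟨τ, hτ, h⟩ := hz
  obtain ⟨t, ht, h'⟩ := (D.isCircularArc d).exists_param hτ
  refine ⟨t, ht, ?_⟩
  rw [D.arc_zero, D.arc_one] at h'
  change _ = (τ : ℂ) * D.dir d * _ at h'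
  have hne' : D.pos d.snd - D.pos d.fst ≠ 0 := sub_ne_zero.2 hne.symm
  have h0 : D.pos d.snd - D.pos d.fst + τ * D.dir d ≠ 0 := by
    intro e
    apply pow_ne_zero 2 hne'
    linear_combination h' + (D.pos d.snd - D.arc d t) * e
  apply mul_left_cancel₀ h0
  linear_combination h' - h

/-- A zero would mean that the parameter τ belongs to the point at infinity, but an interior point
of the edge already has it. -/
lemma bounded_edgePoints (d : G.Dart) (hne : D.pos d.fst ≠ D.pos d.snd) {τ : ℝ} (hτ : 0 < τ) :
    D.pos d.snd - D.pos d.fst + τ * D.dir d ≠ 0 := by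
  obtain ⟨t, ht, h'⟩ := (D.isCircularArc d).exists_param hτ
  rw [D.arc_zero, D.arc_one] at h'
  change _ = (τ : ℂ) * D.dir d * _ at h'
  intro e
  apply pow_ne_zero 2 (sub_ne_zero.2 hne.symm)
  linear_combination h' + (D.pos d.snd - D.arc d t) * e

lemma dir_mul_dir_symm (d : G.Dart) :
    D.dir d * D.dir d.symm * ‖D.pos d.snd - D.pos d.fst‖ ^ 2 =
      -(D.pos d.snd - D.pos d.fst) ^ 2 := by
  have h := (D.isCircularArc d).deriv_mul_deriv
  have h1 : deriv (D.arc d.symm) 0 = -deriv (D.arc d) 1 := by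
    rw [funext (D.arc_symm d), deriv_comp_const_sub, sub_zero]
  rw [D.arc_zero, D.arc_one] at h
  rw [dir, dir, h1, norm_neg]
  exact h

end ArcDrawing

/-! ### Equally spaced directions in the order of the rotation system -/

lemma RotationSystem.ncard_neighborSet (ρ : RotationSystem G) (v : V) :
    (G.neighborSet v).ncard = (ρ.nbrs v).length := by
  classical
  have : G.neighborSet v = ((ρ.nbrs v).toFinset : Set V) := by
    ext w
    simp [ρ.mem_nbrs]
  rw [this, Set.ncard_coe_finset, List.toFinset_card_of_nodup (ρ.nodup v)]

/-- Strictly increasing integers, n in number, that span less than n must be consecutive. Applied to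
directions measured in units of 2π/n, this turns cyclic order and equal spacing into explicit
positions. -/
lemma eq_add_of_strictMono_of_lt_add {n : ℕ} {M : Fin n → ℤ} (hM : StrictMono M)
    (h : ∀ i j, M j < M i + n) (i : Fin n) (hn : 0 < n) : M i = M ⟨0, hn⟩ + i := by
  have key : ∀ d (i j : Fin n), j.val = i.val + d → M i + d ≤ M j := by
    intro d
    induction d with
    | zero =>
      intro i j e
      rw [show j = i from Fin.ext e]
      simp
    | succ d ih =>
      intro i j e
      have h1 := ih i ⟨i + d, by omega⟩ rfl
      have h2 : M ⟨i + d, by omega⟩ < M j := hM (Fin.lt_def.2 (by simp only; omega))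
      push_cast
      omega
  have h1 := key i ⟨0, hn⟩ i (by simp)
  have h2 := key (n - 1 - i) i ⟨n - 1, by omega⟩ (by simp only; omega)
  have h3 := h ⟨0, hn⟩ ⟨n - 1, by omega⟩
  omega

variable {D}

/-- In a Lombardi drawing that follows a rotation system the edges leave every vertex in equally
spaced directions, in the order given by the rotation system. -/
lemma ArcDrawing.FollowsCounterclockwise.exists_dir_eq {ρ : RotationSystem G}
    (h : D.FollowsCounterclockwise ρ) (hL : D.IsLombardi) (v : V) :
    ∃ Z : ℂ, ‖Z‖ = 1 ∧ ∀ d : G.Dart, d.fst = v → ∀ j : ℕ, (ρ.nbrs v)[j]? = some d.snd →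
      D.dir d = Z * cis (2 * Real.pi / (ρ.nbrs v).length) ^ j := by
  obtain ⟨θ, hθ, hθ', hdir⟩ := h v
  obtain ⟨φ, hφ⟩ := hL v
  rw [ρ.ncard_neighborSet] at hφ
  rcases Nat.eq_zero_or_pos (ρ.nbrs v).length with h0 | h0
  · refine ⟨1, by simp, fun d _ j hj => ?_⟩
    obtain ⟨hjn, -⟩ := List.getElem?_eq_some_iff.1 hj
    omega
  have hn0 : (0 : ℝ) < (ρ.nbrs v).length := by exact_mod_cast h0
  have hpi := Real.pi_pos
  have hM : ∀ i, ∃ M : ℤ, θ i = φ + 2 * Real.pi / (ρ.nbrs v).length * M := by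
    intro i
    let d : G.Dart := ⟨(v, (ρ.nbrs v).get i), (ρ.mem_nbrs v _).1 (List.get_mem _ _)⟩
    have h1 : D.dir d ∈ {z : ℂ | ∃ d : G.Dart, d.fst = v ∧ D.dir d = z} := ⟨d, rfl, rfl⟩
    rw [hφ] at h1
    obtain ⟨j, -, hj⟩ := h1
    rw [hdir d i rfl rfl, Complex.exp_eq_exp_iff_exists_int] at hj
    obtain ⟨m, hm⟩ := hj
    refine ⟨j + m * (ρ.nbrs v).length, ?_⟩
    push_cast
    rw [mul_add, ← mul_assoc, mul_comm _ (m : ℝ), mul_assoc (m : ℝ), div_mul_cancel₀ _ hn0.ne']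
    have h3 : θ i = φ + 2 * Real.pi * j / (ρ.nbrs v).length + m * (2 * Real.pi) := by
      have h4 := congrArg (fun z : ℂ => (z / Complex.I).re) hm
      have h5 : ((φ + 2 * Real.pi * j / (ρ.nbrs v).length : ℝ) * Complex.I + m * (2 * Real.pi * Complex.I)) /
          Complex.I = ((φ + 2 * Real.pi * j / (ρ.nbrs v).length + m * (2 * Real.pi) : ℝ) : ℂ) := by
        push_cast
        field_simp
      have h6 : (θ i * Complex.I) / Complex.I = (θ i : ℂ) := by field_simp
      simp only [h5, h6, Complex.ofReal_re] at h4
      exact h4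
    rw [h3]
    ring
  choose M hM using hM
  have hpos : 0 < 2 * Real.pi / (ρ.nbrs v).length := by positivity
  have hM1 : StrictMono M := by
    intro i j hij
    have := hθ hij
    rw [hM, hM, add_lt_add_iff_left, mul_lt_mul_iff_right₀ hpos] at this
    exact_mod_cast this
  have hM2 : ∀ i j, M j < M i + (ρ.nbrs v).length := by
    intro i j
    have h1 := hθ' i j
    have h2 : 2 * Real.pi = 2 * Real.pi / (ρ.nbrs v).length * (ρ.nbrs v).length := by field_simp
    rw [hM, hM, add_assoc, add_lt_add_iff_left] at h1
    nth_rewrite 3 [h2] at h1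
    rw [← mul_add, mul_lt_mul_iff_right₀ hpos] at h1
    exact_mod_cast h1
  refine ⟨cis (φ + 2 * Real.pi / (ρ.nbrs v).length * M ⟨0, h0⟩), norm_cis _, fun d hd j hj => ?_⟩
  obtain ⟨hjn, hj⟩ := List.getElem?_eq_some_iff.1 hj
  rw [hdir d ⟨j, hjn⟩ hd hj.symm]
  change cis _ = _
  rw [hM, eq_add_of_strictMono_of_lt_add hM1 hM2 _ h0, ← cis_nat_mul, ← cis_add]
  push_cast
  ring_nf

/-- The sign ε records the orientation: reversing a list of length n replaces j by n - 1 - j, which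
inverts the root of unity and changes the base direction Z. -/
lemma ArcDrawing.Respects.exists_dir_eq {ρ : RotationSystem G}
    (h : D.Respects ρ) (hL : D.IsLombardi) :
    ∃ ε : ℝ, (ε = 1 ∨ ε = -1) ∧ ∀ v, ∃ Z : ℂ, ‖Z‖ = 1 ∧ ∀ d : G.Dart, d.fst = v → ∀ j : ℕ,
      (ρ.nbrs v)[j]? = some d.snd →
        D.dir d = Z * cis (ε * (2 * Real.pi / (ρ.nbrs v).length)) ^ j := by
  rcases h with h | h
  · refine ⟨1, Or.inl rfl, fun v => ?_⟩
    simpa using h.exists_dir_eq hL v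
  · refine ⟨-1, Or.inr rfl, fun v => ?_⟩
    obtain ⟨Z, hZ, hd⟩ := h.exists_dir_eq hL v
    have hlen : (ρ.mirror.nbrs v).length = (ρ.nbrs v).length := List.length_reverse
    rw [hlen] at hd
    obtain ⟨ζ, hζ⟩ : ∃ ζ, ζ = cis (2 * Real.pi / (ρ.nbrs v).length) := ⟨_, rfl⟩
    rw [← hζ] at hd
    refine ⟨Z * ζ ^ ((ρ.nbrs v).length - 1), by simp [hZ, hζ, norm_cis], fun d hdv j hj => ?_⟩
    obtain ⟨hjn, -⟩ := List.getElem?_eq_some_iff.1 hj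
    have h1 : (ρ.mirror.nbrs v)[(ρ.nbrs v).length - 1 - j]? = some d.snd := by
      change (ρ.nbrs v).reverse[_]? = _
      rw [List.getElem?_reverse (by omega), ← hj]
      congr 1
      omega
    rw [hd d hdv _ h1, neg_one_mul, cis_neg, ← hζ]
    have h2 : ζ ^ ((ρ.nbrs v).length - 1) = ζ ^ ((ρ.nbrs v).length - 1 - j) * ζ ^ j := by
      rw [← pow_add]; congr 1; omega
    have h3 : ζ ≠ 0 := hζ ▸ cis_ne_zero _
    rw [h2, inv_pow]
    field_simp

end

/-! ### The spokes of a drawing of S(k) -/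

lemma getElem?_flatMap_of_length_eq {α β : Type*} {f : α → List β} {m : ℕ}
    (hf : ∀ a, (f a).length = m) (l : List α) (i : ℕ) {c : ℕ} (hc : c < m) :
    (l.flatMap f)[m * i + c]? = l[i]?.bind fun a => (f a)[c]? := by
  induction l generalizing i with
  | nil => simp
  | cons a l ih =>
    rw [List.flatMap_cons]
    cases i with
    | zero => rw [mul_zero, zero_add, List.getElem?_append_left (by rw [hf]; exact hc)]; simp
    | succ i =>
      rw [List.getElem?_append_right (by rw [hf]; nlinarith), hf,
        show m * (i + 1) + c - m = m * i + c by rw [mul_add, mul_one]; omega, ih]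
      simp

open SVertex

lemma length_sNbrs_yellow (k : ℕ) (y : Pole) : (sNbrs k (yellow y)).length = 4 * k := by
  cases y <;> simp [sNbrs, List.length_flatMap, mul_comm]

lemma length_sNbrs_blue {k : ℕ} (i : Fin k) (σ : Side) : (sNbrs k (blue i σ)).length = 4 * k := by
  have := i.pos
  cases σ <;> simp [sNbrs, redPath] <;> omega

/-- The position of a blue vertex in its quadruple of consecutive neighbours of a yellow vertex. -/
def Side.index : Side → ℕ
  | .l => 1
  | .r => 2

lemma Side.index_lt (σ : Side) : σ.index < 4 := by cases σ <;> simp [Side.index]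

lemma getElem?_flatMap_blue {k : ℕ} (y : Pole) (i : Fin k) (σ : Side) :
    ((List.finRange k).flatMap fun i =>
      [redHead y i .l, blue i .l, blue i .r, redHead y i .r])[4 * i.val + σ.index]? =
        some (blue i σ) := by
  rw [getElem?_flatMap_of_length_eq (m := 4) (fun _ => rfl) _ _ σ.index_lt]
  cases σ <;> simp [Side.index]

lemma getElem?_sNbrs_s {k : ℕ} (i : Fin k) (σ : Side) :
    (sNbrs k (yellow .s))[4 * i.val + σ.index]? = some (blue i σ) :=
  getElem?_flatMap_blue .s i σ

lemma getElem?_sNbrs_t {k : ℕ} (i : Fin k) (σ : Side) :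
    (sNbrs k (yellow .t))[4 * k - 1 - (4 * i.val + σ.index)]? = some (blue i σ) := by
  have h := length_sNbrs_yellow k .t
  have h1 := σ.index_lt
  have h2 := i.isLt
  simp only [sNbrs, List.length_reverse] at h ⊢
  rw [List.getElem?_reverse (by omega), h, ← getElem?_flatMap_blue .t i σ]
  congr 1
  omega

/-- The edge from a yellow to a blue vertex. -/
def yellowBlue {k : ℕ} (y : Pole) (i : Fin k) (σ : Side) : (S k).Dart :=
  ⟨(yellow y, blue i σ), by simp [S, SEdge]⟩

lemma yellowBlue_edge_injective {k : ℕ} {y y' : Pole} {i i' : Fin k} {σ σ' : Side}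
    (h : (yellowBlue y i σ).edge = (yellowBlue y' i' σ').edge) : y = y' ∧ i = i' ∧ σ = σ' := by
  simpa [yellowBlue, SimpleGraph.Dart.edge] using h

lemma ArcDrawing.IsPlanar.disjoint_edgePoints {V : Type*} {G : SimpleGraph V} {D : ArcDrawing G}
    (hD : D.IsPlanar) {d d' : G.Dart} (h : d.edge ≠ d'.edge) :
    Disjoint (edgePoints (D.pos d.fst) (D.pos d.snd) (D.dir d))
      (edgePoints (D.pos d'.fst) (D.pos d'.snd) (D.dir d')) := by
  refine Set.disjoint_left.2 fun z h1 h2 => ?_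
  obtain ⟨x, hx, hz⟩ := D.exists_arc_eq d (hD.1.ne d.fst_ne_snd) h1
  obtain ⟨x', hx', hz'⟩ := D.exists_arc_eq d' (hD.1.ne d'.fst_ne_snd) h2
  exact hD.2.2 d d' h x hx x' hx' (hz.trans hz'.symm)

lemma ArcDrawing.IsPlanar.pos_notMem_edgePoints {V : Type*} {G : SimpleGraph V} {D : ArcDrawing G}
    (hD : D.IsPlanar) (d : G.Dart) (v : V) :
    D.pos v ∉ edgePoints (D.pos d.fst) (D.pos d.snd) (D.dir d) := by
  intro h
  obtain ⟨x, hx, hz⟩ := D.exists_arc_eq d (hD.1.ne d.fst_ne_snd) h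
  exact hD.2.1 d v x hx hz

lemma pow_four_mul_mod {k : ℕ} {ω : ℂ} (hω : ω ^ (4 * k) = 1) (n c : ℕ) :
    ω ^ (4 * (n % k) + c) = ω ^ (4 * n + c) := by
  conv_rhs => rw [← Nat.mod_add_div n k]
  rw [mul_add, add_right_comm, pow_add _ _ (4 * (k * (n / k))), ← mul_assoc, pow_mul ω (4 * k), hω,
    one_pow, mul_one]

/-- The angle at the blue vertex `b` between its edges to `s` and `t`, in terms of the directions
`S` and `Q` in which these edges arrive at `s` and `t`. -/
lemma sq_mul_eq_of_dir_eq {x y S S' Q Q' ω : ℂ}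
    (h1 : S * S' * ‖x‖ ^ 2 = -x ^ 2) (h2 : Q * Q' * ‖y‖ ^ 2 = -y ^ 2)
    (h : S' = Q' * ω) : x ^ 2 * ‖y‖ ^ 2 * Q = y ^ 2 * ‖x‖ ^ 2 * S * ω := by
  rw [h] at h1
  linear_combination (‖y‖ ^ 2 * Q) * h1 - (‖x‖ ^ 2 * S * ω) * h2

theorem exists_spokes {k : ℕ} (hk : 0 < k) {D : ArcDrawing (S k)} (hL : D.IsLombardi)
    (hP : D.IsPlanar) (hR : D.Respects (sEmbedding k)) :
    ∃ ε : ℝ, (ε = 1 ∨ ε = -1) ∧ ∃ (s t : ℂ) (b P Q : Side → ℕ → ℂ),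
      Spokes k (cis (ε * (2 * Real.pi / (4 * k : ℕ)))) s t b P Q := by
  obtain ⟨ε, hε, hdir⟩ := hR.exists_dir_eq hL
  refine ⟨ε, hε, ?_⟩
  have hlen : ∀ v, ((sEmbedding k).nbrs v).length = (sNbrs k v).length := fun _ => rfl
  set ω := cis (ε * (2 * Real.pi / (4 * k : ℕ))) with hω
  have hω0 : ω ≠ 0 := cis_ne_zero _
  have hk0 : (k : ℝ) ≠ 0 := by exact_mod_cast hk.ne'
  have hω4 : ω ^ (4 * k) = 1 := by
    have h1 : ((4 * k : ℕ) : ℝ) * (ε * (2 * Real.pi / (4 * k : ℕ))) = ε * (2 * Real.pi) := by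
      push_cast; field_simp
    rw [hω, ← cis_nat_mul, h1]
    rcases hε with rfl | rfl
    · rw [one_mul, cis_two_pi]
    · rw [neg_one_mul, cis_neg, cis_two_pi, inv_one]
  have hω4' : ω⁻¹ ^ (4 * k) = 1 := by rw [inv_pow, hω4, inv_one]
  have hωn : ‖ω‖ = 1 := norm_cis _
  obtain ⟨Zs, hZs, hs⟩ := hdir (yellow .s)
  obtain ⟨Zt, hZt, ht⟩ := hdir (yellow .t)
  rw [hlen, length_sNbrs_yellow, ← hω] at hs ht
  let idx : ℕ → Fin k := fun n => ⟨n % k, Nat.mod_lt n hk⟩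
  have hidx : ∀ n, idx (n + k) = idx n := fun n => by simp [idx]
  let P : Side → ℕ → ℂ := fun σ n => D.dir (yellowBlue .s (idx n) σ)
  let Q : Side → ℕ → ℂ := fun σ n => D.dir (yellowBlue .t (idx n) σ)
  have hPs : ∀ σ n, P σ n = Zs * ω ^ (4 * n + σ.index) := fun σ n => by
    rw [← pow_four_mul_mod hω4]
    exact hs _ rfl _ (getElem?_sNbrs_s (idx n) σ)
  -- The list at t is reversed, so positions count down from 4k - 1 and ω is replaced by its
  -- inverse.
  have hQt : ∀ σ n, Q σ n = Zt * ω ^ (4 * k - 1) * ω⁻¹ ^ (4 * n + σ.index) := fun σ n => by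
    rw [← pow_four_mul_mod hω4']
    have h1 := ht (yellowBlue .t (idx n) σ) rfl _ (getElem?_sNbrs_t (idx n) σ)
    have h2 : 4 * k - 1 = (4 * k - 1 - (4 * (n % k) + σ.index)) + (4 * (n % k) + σ.index) := by
      have := Nat.mod_lt n hk
      have := σ.index_lt
      omega
    refine h1.trans ?_
    conv_rhs => rw [h2, pow_add]
    rw [mul_assoc, mul_assoc, ← mul_pow, mul_inv_cancel₀ hω0, one_pow, mul_one]
  have hPn : ∀ σ n, ‖P σ n‖ = 1 := fun σ n => by rw [hPs]; simp [hZs, hωn]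
  have hQn : ∀ σ n, ‖Q σ n‖ = 1 := fun σ n => by rw [hQt]; simp [hZt, hωn]
  have hblue_l : ∀ n, D.dir (yellowBlue .s (idx n) .l).symm =
      D.dir (yellowBlue .t (idx n) .l).symm * ω := by
    intro n
    obtain ⟨Z, -, hZ⟩ := hdir (blue (idx n) .l)
    rw [hlen, length_sNbrs_blue, ← hω] at hZ
    -- The list of a left blue vertex begins with t, s; that of a right one begins with s, t, hence
    -- ω⁻¹ there.
    rw [hZ (yellowBlue .s (idx n) .l).symm rfl 1 rfl,
      hZ (yellowBlue .t (idx n) .l).symm rfl 0 rfl]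
    ring
  have hblue_r : ∀ n, D.dir (yellowBlue .s (idx n) .r).symm =
      D.dir (yellowBlue .t (idx n) .r).symm * ω⁻¹ := by
    intro n
    obtain ⟨Z, -, hZ⟩ := hdir (blue (idx n) .r)
    rw [hlen, length_sNbrs_blue, ← hω] at hZ
    rw [hZ (yellowBlue .s (idx n) .r).symm rfl 0 rfl,
      hZ (yellowBlue .t (idx n) .r).symm rfl 1 rfl]
    field_simp
  have hdisj : ∀ y σ σ' m n, (σ = σ' → ¬ m ≡ n [MOD k]) →
      (yellowBlue y (idx m) σ).edge ≠ (yellowBlue y (idx n) σ').edge := by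
    intro y σ σ' m n h e
    obtain ⟨-, h1, h2⟩ := yellowBlue_edge_injective e
    exact h h2 (Fin.ext_iff.1 h1)
  exact ⟨D.pos (yellow .s), D.pos (yellow .t), fun σ n => D.pos (blue (idx n) σ), P, Q,
    { poles_ne := hP.1.ne (by simp)
      ne_s := fun σ n => hP.1.ne (by simp)
      ne_t := fun σ n => hP.1.ne (by simp)
      periodic_b := fun σ n => by rw [hidx]
      periodic_S := fun σ n => by simp only [P, hidx]
      norm_S := hPn
      norm_Q := hQn
      S_r := fun n => by rw [hPs, hPs]; simp only [Side.index]; ring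
      S_succ := fun n => by rw [hPs, hPs]; ring
      Q_r := fun n => by rw [hQt, hQt]; simp only [Side.index]; ring
      Q_succ := fun n => by rw [hQt, hQt]; ring
      angle_l := fun n => sq_mul_eq_of_dir_eq (D.dir_mul_dir_symm (yellowBlue .s (idx n) .l))
        (D.dir_mul_dir_symm (yellowBlue .t (idx n) .l)) (hblue_l n)
      angle_r := fun n => sq_mul_eq_of_dir_eq (D.dir_mul_dir_symm (yellowBlue .s (idx n) .r))
        (D.dir_mul_dir_symm (yellowBlue .t (idx n) .r)) (hblue_r n)
      bounded_s := fun σ n τ hτ => D.bounded_edgePoints (yellowBlue .s (idx n) σ)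
        (hP.1.ne (SimpleGraph.Dart.fst_ne_snd _)) hτ
      bounded_t := fun σ n τ hτ => D.bounded_edgePoints (yellowBlue .t (idx n) σ)
        (hP.1.ne (SimpleGraph.Dart.fst_ne_snd _)) hτ
      t_notMem := fun σ n => hP.pos_notMem_edgePoints (yellowBlue .s (idx n) σ) _
      s_notMem := fun σ n => hP.pos_notMem_edgePoints (yellowBlue .t (idx n) σ) _
      disjoint_s := fun σ σ' m n h => hP.disjoint_edgePoints (hdisj .s σ σ' m n h)
      disjoint_t := fun σ σ' m n h => hP.disjoint_edgePoints (hdisj .t σ σ' m n h)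
      disjoint_s_t := fun σ σ' m n => hP.disjoint_edgePoints
        (d := yellowBlue .s (idx m) σ) (d' := yellowBlue .t (idx n) σ')
        fun e => by simpa using (yellowBlue_edge_injective e).1 }⟩

end Lombardi

theorem theorem2 (k : ℕ) (hk : 8 < k) :
    ¬ ∃ D : Lombardi.ArcDrawing (Lombardi.S k),
      D.IsLombardi ∧ D.IsPlanar ∧ D.Respects (Lombardi.sEmbedding k) := by
  rintro ⟨D, hL, hP, hR⟩
  obtain ⟨ε, hε, s, t, b, P, Q, h⟩ := Lombardi.exists_spokes (by omega) hL hP hR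
  have hk0 : (k : ℝ) ≠ 0 := by exact_mod_cast (by omega : k ≠ 0)
  have ha : 2 * k * (2 * Real.pi / (4 * k : ℕ)) = Real.pi := by
    push_cast; field_simp; norm_num
  rcases hε with rfl | rfl
  · rw [one_mul] at h
    exact h.false hk ha
  -- The mirrored embedding: reflecting the whole configuration of spokes brings back the positive
  -- orientation.
  · rw [neg_one_mul, ← Lombardi.conj_cis] at h
    have h' := h.conj
    rw [Complex.conj_conj] at h'
    exact h'.false hk ha
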